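/- Let $d\ge 1$ and let $k_1\ge k_2\ge\dots\ge k_d\ge 3$ be integers. Let $T^{(d)}_{k_1,\dots,k_d}=R_{k_1}\times\cdots\times R_{k_d}$ be the $d$-dimensional torus, i.e. the Cartesian product of the rings (cycles) $R_{k_i}$ on $k_i$ vertices; two vertices of the product are adjacent if and only if they are adjacent in one coordinate and equal in all the others. For a finite graph $G$ with $n$ vertices let the bisection width $BW(G)$ be the minimum, over all sets $S\subseteq V(G)$ with $|S|=\lfloor n/2\rfloor$, of the number of edges of $G$ with exactly one endpoint in $S$. Then $$BW\bigl(T^{(d)}_{k_1,\dots,k_d}\bigr)=2\sum_{i=1}^{e}C_i,\qquad C_i=\prod_{j=i+1}^{d}k_j,$$ where $e$ is the smallest index $i$ for which $k_i$ is even, and $e=d$ if all $k_i$ are odd. -/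

import Mathlib

/-- The Cartesian (box) product of a family of graphs: two vertices are adjacent iff they are
adjacent in exactly one coordinate and agree in all the others. -/
def cartesianProduct {ι : Type*} {V : ι → Type*} (G : ∀ i, SimpleGraph (V i)) :
    SimpleGraph (∀ i, V i) where
  Adj u v := ∃ i, (G i).Adj (u i) (v i) ∧ ∀ j, j ≠ i → u j = v j
  symm := ⟨fun _ _ ⟨i, h, h'⟩ => ⟨i, h.symm, fun j hj => (h' j hj).symm⟩⟩
  loopless := ⟨fun _ ⟨_, h, _⟩ => h.ne rfl⟩

/-- The `d`-dimensional torus: the Cartesian product of `d` rings with `k 0, …, k (d - 1)`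
vertices. -/
def torus {d : ℕ} (k : Fin d → ℕ) : SimpleGraph (∀ i, Fin (k i)) :=
  cartesianProduct fun i => SimpleGraph.cycleGraph (k i)

open Classical in
/-- The number of edges of `G` between `S` and its complement. Each such edge is counted once, as
the pair of its endpoint in `S` and its endpoint outside `S`. -/
noncomputable def cutSize {V : Type*} [Fintype V] (G : SimpleGraph V) (S : Finset V) : ℕ :=
  (G.interedges S Sᶜ).card

/-- The bisection width of a finite graph with `n` vertices: the minimum number of edges between
`S` and its complement over all vertex sets `S` with `⌊n / 2⌋` elements. -/
noncomputable def bisectionWidth {V : Type*} [Fintype V] (G : SimpleGraph V) : ℕ :=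
  sInf {c | ∃ S : Finset V, S.card = Fintype.card V / 2 ∧ cutSize G S = c}

open Classical in
/-- The lowest dimension, numbered from `1` to `d`, in which the number of vertices is even, and
`d` if there is none. Dimension `i + 1` has `k i` vertices. -/
noncomputable def lowestEvenDim {d : ℕ} (k : Fin d → ℕ) : ℕ :=
  if h : ∃ i : ℕ, ∃ hi : i < d, Even (k ⟨i, hi⟩) then Nat.find h + 1 else d

/-!
A proper nonempty set of vertices of a ring is left by at least two edges, while a set of `a`
vertices of the complete graph on `k` vertices cuts `a (k - a) ≤ ⌊k / 2⌋ ⌈k / 2⌉` edges. The cut of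
a set in the torus is therefore at least twice its cut in the product of the complete graphs, where
an edge in direction `i` has weight `1 / (⌊k i / 2⌋ ⌈k i / 2⌉)`. Among the sets of a given size, the
initial segments of the lexicographic order minimise this weighted cut (as in Lindsey's theorem):
replacing each layer by an initial segment of the same size does not increase the cut. If this makes
no progress in any of at least three directions, then moving the last point of the set to the first
missing one does not increase the cut either. In two directions the claim is an inequality
for the `m`-periodic function that equals `z (m - z)` on `[0, m]`. Finally, the initial segment
containing half of the grid meets every line of the grid in the empty set, in the whole line, or in
half of it, so that its cut in the torus attains the bound.
-/

open Finset Function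

/-- The number of edges of the complete graph on `m` vertices cut by a set of `z` vertices,
extended `m`-periodically to all integers `z`. -/
def periodicCut (m z : ℤ) : ℤ := z % m * (m - z % m)

theorem periodicCut_of_mem {m z : ℤ} (h0 : 0 ≤ z) (hm : z ≤ m) :
    periodicCut m z = z * (m - z) := by
  obtain rfl | hlt := hm.eq_or_lt
  · simp [periodicCut]
  · rw [periodicCut, Int.emod_eq_of_lt h0 hlt]

theorem periodicCut_congr {m a b : ℤ} (h : a ≡ b [ZMOD m]) :
    periodicCut m a = periodicCut m b := by
  rw [periodicCut, periodicCut, h]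

theorem periodicCut_nonneg {m : ℤ} (hm : 0 < m) (z : ℤ) : 0 ≤ periodicCut m z :=
  mul_nonneg (z.emod_nonneg hm.ne') (sub_nonneg.2 (z.emod_lt_of_pos hm).le)

theorem periodicCut_of_dvd {m z : ℤ} (h : m ∣ z) : periodicCut m z = 0 := by
  rw [periodicCut, Int.emod_eq_zero_of_dvd h, zero_mul]

theorem periodicCut_neg {m : ℤ} (hm : 0 < m) (z : ℤ) :
    periodicCut m (-z) = periodicCut m z := by
  have h : -z ≡ m - z % m [ZMOD m] := by
    rw [Int.modEq_iff_dvd, Int.emod_def]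
    exact ⟨1 + z / m, by ring⟩
  rw [periodicCut_congr h, periodicCut_of_mem (sub_nonneg.2 (z.emod_lt_of_pos hm).le)
    (sub_le_self m (z.emod_nonneg hm.ne')), periodicCut]
  ring

theorem periodicCut_sub_comm {m : ℤ} (hm : 0 < m) (a b : ℤ) :
    periodicCut m (a - b) = periodicCut m (b - a) := by
  rw [← periodicCut_neg hm, neg_sub]

theorem periodicCut_sub_of_le {m a b : ℤ} (hm : 0 < m) (h : |a - b| ≤ m) :
    periodicCut m (a - b) = |a - b| * m - (a - b) ^ 2 := by
  rcases le_total 0 (a - b) with h0 | h0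
  · rw [abs_of_nonneg h0] at h ⊢
    rw [periodicCut_of_mem h0 h]; ring
  · rw [abs_of_nonpos h0] at h ⊢
    rw [← periodicCut_neg hm, periodicCut_of_mem (by linarith) h]; ring

theorem periodicCut_add_sub_add {m : ℤ} (hm : 0 < m) (u v : ℤ) :
    periodicCut m u + periodicCut m v - periodicCut m (u + v) =
      2 * min ((u % m) * (v % m)) ((m - u % m) * (m - v % m)) := by
  have hu0 := u.emod_nonneg hm.ne'
  have hv0 := v.emod_nonneg hm.ne'
  have hu := u.emod_lt_of_pos hm
  have hv := v.emod_lt_of_pos hm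
  have h : u + v ≡ u % m + v % m [ZMOD m] :=
    ((Int.mod_modEq u m).add (Int.mod_modEq v m)).symm
  rcases le_total (u % m + v % m) m with hle | hge
  · rw [periodicCut_congr h, periodicCut_of_mem (add_nonneg hu0 hv0) hle,
      min_eq_left (by nlinarith), periodicCut, periodicCut]
    ring
  · have h' : u + v ≡ u % m + v % m - m [ZMOD m] := by
      simpa using h.sub (Int.modEq_zero_iff_dvd.2 dvd_rfl : m ≡ 0 [ZMOD m]).symm
    rw [periodicCut_congr h', periodicCut_of_mem (sub_nonneg.2 hge) (by linarith),
      min_eq_right (by nlinarith), periodicCut, periodicCut]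
    ring

theorem periodicCut_add_le {m : ℤ} (hm : 0 < m) (u v : ℤ) :
    periodicCut m (u + v) ≤ periodicCut m u + periodicCut m v := by
  have := periodicCut_add_sub_add hm u v
  have : 0 ≤ min ((u % m) * (v % m)) ((m - u % m) * (m - v % m)) :=
    le_min (mul_nonneg (u.emod_nonneg hm.ne') (v.emod_nonneg hm.ne'))
      (mul_nonneg (sub_nonneg.2 (u.emod_lt_of_pos hm).le)
        (sub_nonneg.2 (v.emod_lt_of_pos hm).le))
  linarith

theorem periodicCut_le_mul_add_sub {m n : ℤ} (hm : 0 < m) (hn : m - 1 ≤ n) (u : ℤ) {v : ℤ}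
    (hv : ¬ m ∣ v) :
    2 * periodicCut m u ≤
      n * (periodicCut m u + periodicCut m v - periodicCut m (u + v)) := by
  have hu0 : 0 ≤ u % m := u.emod_nonneg hm.ne'
  have hu : u % m + 1 ≤ m := u.emod_lt_of_pos hm
  have hv0 : 1 ≤ v % m := (v.emod_nonneg hm.ne').lt_of_ne'
    fun h ↦ hv (Int.dvd_of_emod_eq_zero h)
  have hv1 : v % m + 1 ≤ m := v.emod_lt_of_pos hm
  have hcut : periodicCut m u ≤ n * min ((u % m) * (v % m)) ((m - u % m) * (m - v % m)) := by
    rw [periodicCut]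
    rcases min_choice ((u % m) * (v % m)) ((m - u % m) * (m - v % m)) with h | h <;> rw [h]
    · obtain h0 | h0 := hu0.eq_or_lt
      · simp [← h0]
      · calc u % m * (m - u % m) ≤ u % m * n := by gcongr; linarith
          _ = n * (u % m * 1) := by ring
          _ ≤ n * (u % m * (v % m)) := by gcongr; linarith
    · calc u % m * (m - u % m) ≤ n * ((m - u % m) * 1) := by
            nlinarith
          _ ≤ n * ((m - u % m) * (m - v % m)) := by gcongr <;> linarith
  rw [periodicCut_add_sub_add hm]
  linarith

section FinSums

variable {n : ℕ}

theorem sum_sum_sub_sq (x : Fin n → ℤ) :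
    ∑ t, ∑ u, (x t - x u) ^ 2 = 2 * n * ∑ t, x t ^ 2 - 2 * (∑ t, x t) ^ 2 := by
  simp only [sub_sq, sum_add_distrib, sum_sub_distrib, ← mul_sum, ← sum_mul, sum_const, card_univ,
    Fintype.card_fin, nsmul_eq_mul]
  ring

theorem two_mul_sum_val (n : ℕ) : 2 * ∑ i : Fin n, (i : ℤ) = n * (n - 1) := by
  induction n with
  | zero => simp
  | succ n ih =>
    simp only [Fin.sum_univ_castSucc, Fin.val_castSucc, Fin.val_last, mul_add, ih]
    push_cast
    ring

theorem sq_sum_add_sum_mul_nonneg {ι : Type*} {s : Finset ι} {y c : ι → ℤ}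
    (hy : ∀ i ∈ s, 0 ≤ y i) (hc : ∀ i ∈ s, 0 ≤ c i) :
    0 ≤ (∑ i ∈ s, y i) ^ 2 + ∑ i ∈ s, y i * (2 * c i - y i) := by
  have hsq := sum_sq_le_sq_sum_of_nonneg hy
  have hle : -∑ i ∈ s, y i ^ 2 ≤ ∑ i ∈ s, y i * (2 * c i - y i) := by
    rw [← sum_neg_distrib]
    exact sum_le_sum fun i hi ↦ by nlinarith [mul_nonneg (hy i hi) (hc i hi)]
  linarith

theorem sq_sum_add_sum_eq {p q : ℕ} (f : Fin (p + q) → ℤ) :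
    (∑ i, f i) ^ 2 + ∑ i : Fin (p + q), (2 * (i : ℤ) * f i - f i ^ 2)
        - 2 * (p + q - 1) * ∑ i, f i =
      (∑ i, (f (Fin.natAdd p i) - 1) - ∑ i, -f (Fin.castAdd q i)) ^ 2
      + ∑ i : Fin p, -f (Fin.castAdd q i) * (2 * (p - 1 - (i : ℤ)) - -f (Fin.castAdd q i))
      + ∑ i : Fin q, (f (Fin.natAdd p i) - 1) * (2 * (i : ℤ) - (f (Fin.natAdd p i) - 1)) := by
  have hleft :
      ∑ i : Fin p, -f (Fin.castAdd q i) * (2 * (p - 1 - (i : ℤ)) - -f (Fin.castAdd q i)) =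
      ∑ i : Fin p, (2 * (i : ℤ) * f (Fin.castAdd q i) - f (Fin.castAdd q i) ^ 2)
        - 2 * (p - 1) * ∑ i, f (Fin.castAdd q i) := by
    rw [mul_sum, ← sum_sub_distrib]
    exact sum_congr rfl fun i _ ↦ by ring
  have hright :
      ∑ i : Fin q, (f (Fin.natAdd p i) - 1) * (2 * (i : ℤ) - (f (Fin.natAdd p i) - 1)) =
      ∑ i : Fin q, (2 * (p + (i : ℤ)) * f (Fin.natAdd p i) - f (Fin.natAdd p i) ^ 2)
        + (2 - 2 * p) * ∑ i, f (Fin.natAdd p i) - q * (q - 1) - q := by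
    have hone : ∑ _i : Fin q, (1 : ℤ) = q := by simp
    rw [← two_mul_sum_val q, ← hone, mul_sum, mul_sum, ← sum_add_distrib, ← sum_sub_distrib,
      ← sum_sub_distrib]
    exact sum_congr rfl fun i _ ↦ by ring
  rw [hleft, hright]
  simp only [Fin.sum_univ_add, Fin.val_castAdd, Fin.val_natAdd, Nat.cast_add, sum_sub_distrib,
    sum_neg_distrib, sum_const, card_univ, Fintype.card_fin, nsmul_eq_mul]
  ring

theorem two_mul_sum_le_sq_sum_add_sum {f : Fin n → ℤ} (hf : Monotone f)
    (hf' : Monotone fun i : Fin n ↦ (i : ℤ) - f i) :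
    2 * (n - 1) * ∑ i, f i ≤ (∑ i, f i) ^ 2 + ∑ i : Fin n, (2 * (i : ℤ) * f i - f i ^ 2) := by
  -- Split the index set where `f` becomes positive.
  obtain ⟨p, hp, hfp⟩ : ∃ p ≤ n, ∀ i : Fin n, f i ≤ 0 ↔ i < p :=
    ⟨_, (card_le_univ _).trans_eq (Fintype.card_fin n), fun i ↦
      (Tuple.lt_card_le_iff_apply_le_of_monotone hf).symm⟩
  obtain ⟨q, rfl⟩ := Nat.exists_eq_add_of_le hp
  rw [← sub_nonneg, Nat.cast_add, sq_sum_add_sum_eq f]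
  set g : Fin p → ℤ := fun i ↦ -f (Fin.castAdd q i)
  set h : Fin q → ℤ := fun i ↦ f (Fin.natAdd p i) - 1
  have hg0 (i : Fin p) : 0 ≤ g i := neg_nonneg.2 ((hfp _).2 i.2)
  have hh0 (i : Fin q) : 0 ≤ h i :=
    sub_nonneg.2 (not_le.1 fun hle ↦ ((hfp _).1 hle).not_ge (Nat.le_add_right p i))
  obtain rfl | hq := q.eq_zero_or_pos
  · simpa only [univ_eq_empty, sum_empty, zero_sub, neg_sq, add_zero] using
      sq_sum_add_sum_mul_nonneg (s := univ) (c := fun i : Fin p ↦ (p - 1 - i : ℤ))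
        (fun i _ ↦ hg0 i) fun i _ ↦ by have := i.2; lia
  obtain rfl | hp0 := p.eq_zero_or_pos
  · simpa only [univ_eq_empty, sum_empty, sub_zero, add_zero] using
      sq_sum_add_sum_mul_nonneg (s := univ) (c := fun i : Fin q ↦ (i : ℤ))
        (fun i _ ↦ hh0 i) fun i _ ↦ Nat.cast_nonneg _
  let last : Fin p := ⟨p - 1, by lia⟩
  let first : Fin q := ⟨0, hq⟩
  have hg_le (i : Fin p) : g i ≤ p - 1 - i := by
    have hle := hf' (show Fin.castAdd q i ≤ Fin.natAdd p first from i.2.le)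
    simp only [Fin.val_castAdd, Fin.val_natAdd, first] at hle
    have := hh0 first
    grind
  have hh_le (i : Fin q) : h i ≤ i := by
    have hle := hf' (show Fin.castAdd q last ≤ Fin.natAdd p i by
      rw [Fin.le_def, Fin.val_castAdd, Fin.val_natAdd]
      exact (Nat.sub_le p 1).trans (Nat.le_add_right p i))
    simp only [Fin.val_castAdd, Fin.val_natAdd, last, Nat.cast_pred hp0] at hle
    have := hg0 last
    grind
  have hg_sum : 0 ≤ ∑ i, g i * (2 * (p - 1 - (i : ℤ)) - g i) :=
    sum_nonneg fun i _ ↦ mul_nonneg (hg0 i) (by linarith [hg0 i, hg_le i])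
  have hh_sum : 0 ≤ ∑ i, h i * (2 * (i : ℤ) - h i) :=
    sum_nonneg fun i _ ↦ mul_nonneg (hh0 i) (by linarith [hh0 i, hh_le i])
  positivity

theorem two_mul_mul_sub_le_of_monotone {e : Fin n → ℤ} (he : Monotone e)
    (he' : Monotone fun i : Fin n ↦ (i : ℤ) - e i) :
    2 * (n - 1) * ((∑ i : Fin n, ((i : ℤ) - e i)) * (n - ∑ i : Fin n, ((i : ℤ) - e i))) ≤
      ∑ i : Fin n, ∑ j : Fin n, (((i : ℤ) - j) ^ 2 - (e i - e j) ^ 2) := by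
  have hkey := two_mul_sum_le_sq_sum_add_sum he' (by simpa using he)
  set F := ∑ i : Fin n, ((i : ℤ) - e i) with hF
  have hsq : ∑ i : Fin n, (2 * (i : ℤ) * (i - e i) - (i - e i) ^ 2) =
      ∑ i : Fin n, (i : ℤ) ^ 2 - ∑ i, e i ^ 2 := by
    rw [← sum_sub_distrib]
    exact sum_congr rfl fun i _ ↦ by ring
  have hval := two_mul_sum_val n
  rw [hsq] at hkey
  rw [sum_sub_distrib] at hF
  simp only [sum_sub_distrib (s := univ), sum_sum_sub_sq]
  have hn : (0 : ℤ) ≤ 2 * n := by positivity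
  have := mul_le_mul_of_nonneg_left hkey hn
  rw [show ∑ i, e i = ∑ i : Fin n, (i : ℤ) - F by linarith]
  linear_combination this + 2 * F * hval

theorem monotone_sub_of_ordConnected {e : Fin n → ℤ} (he : Monotone e)
    (hr : (Set.range e).OrdConnected) : Monotone fun i : Fin n ↦ (i : ℤ) - e i := by
  cases n with
  | zero => exact fun i ↦ i.elim0
  | succ n =>
    refine Fin.monotone_iff_le_succ.2 fun i ↦ ?_
    have hstep : e i.succ ≤ e i.castSucc + 1 := by
      by_contra! h
      obtain ⟨l, hl⟩ := hr.out ⟨i.castSucc, rfl⟩ ⟨i.succ, rfl⟩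
        ⟨(lt_add_one (e i.castSucc)).le, h.le⟩
      rcases le_or_gt l i.castSucc with hli | hli
      · linarith [he hli]
      · linarith [he (Fin.castSucc_lt_iff_succ_le.1 hli)]
    simp only [Fin.val_castSucc, Fin.val_succ, Nat.cast_add, Nat.cast_one]
    linarith

theorem two_mul_mul_sub_le_of_ordConnected {e : Fin n → ℤ} (hr : (Set.range e).OrdConnected) :
    2 * (n - 1) * ((∑ i : Fin n, ((i : ℤ) - e i)) * (n - ∑ i : Fin n, ((i : ℤ) - e i))) ≤
      ∑ i : Fin n, ∑ j : Fin n, (((i : ℤ) - j) ^ 2 - (e i - e j) ^ 2) := by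
  have hmono := Tuple.monotone_sort e
  have hrange : Set.range (e ∘ Tuple.sort e) = Set.range e := (Tuple.sort e).surjective.range_comp e
  have := two_mul_mul_sub_le_of_monotone hmono
    (monotone_sub_of_ordConnected hmono (hrange ▸ hr))
  simp only [sum_sub_distrib (s := univ), sum_sum_sub_sq, Function.comp_apply] at this ⊢
  rwa [Equiv.sum_comp (Tuple.sort e) e, Equiv.sum_comp (Tuple.sort e) (fun i ↦ e i ^ 2)] at this

theorem two_mul_periodicCut_le_of_ordConnected {e : Fin n → ℤ}
    (hr : (Set.range e).OrdConnected) :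
    2 * (n - 1) * periodicCut n (∑ i : Fin n, ((i : ℤ) - e i)) ≤
      ∑ i : Fin n, ∑ j : Fin n, (((i : ℤ) - j) ^ 2 - (e i - e j) ^ 2) := by
  -- Adding the quotient to `e` replaces the sum by its residue mod `n`.
  set q : ℤ := (∑ i : Fin n, ((i : ℤ) - e i)) / n with hq
  have hr' : (Set.range fun i ↦ e i + q).OrdConnected := by
    rw [show (fun i ↦ e i + q) = OrderIso.addRight q ∘ e from rfl, Set.range_comp]
    infer_instance
  have hsum : ∑ i : Fin n, ((i : ℤ) - (e i + q)) = (∑ i : Fin n, ((i : ℤ) - e i)) % n := by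
    rw [Int.emod_def, ← hq]
    simp only [sum_sub_distrib, sum_add_distrib, sum_const, card_univ, Fintype.card_fin,
      nsmul_eq_mul]
    ring
  simpa only [hsum, add_sub_add_right_eq_sub, periodicCut] using
    two_mul_mul_sub_le_of_ordConnected hr'

theorem exists_eq_of_monotone_sub {e : Fin n → ℤ} (he : Monotone fun i : Fin n ↦ (i : ℤ) - e i)
    {i j : Fin n} (hij : i ≤ j) {v : ℤ} (hi : e i ≤ v) (hj : v ≤ e j) : ∃ l, e l = v := by
  obtain ⟨l, hl⟩ := (Set.toFinite {l | l ≤ j ∧ e l ≤ v}).exists_maximal ⟨i, hij, hi⟩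
  refine ⟨l, hl.prop.2.antisymm ?_⟩
  obtain hlj | hlj := hl.prop.1.eq_or_lt
  · exact hj.trans_eq (congrArg e hlj.symm)
  have hlast : (l : ℕ) + 1 < n := (Nat.succ_le_of_lt hlj).trans_lt j.2
  have hgt : v < e ⟨l + 1, hlast⟩ := by
    by_contra! h
    have := hl.le_of_ge ⟨Nat.succ_le_of_lt hlj, h⟩ (Nat.le_succ l)
    exact (Nat.lt_succ_self l).not_ge this
  have hstep := he (show l ≤ ⟨l + 1, hlast⟩ from Nat.le_succ l)
  push_cast at hstep
  linarith

theorem ordConnected_range_sub {s : Fin n → ℤ} (hs : Monotone s) (h0 : ∀ i, 0 ≤ s i)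
    (h1 : ∀ i, s i < n) : (Set.range fun i : Fin n ↦ (i : ℤ) - s i).OrdConnected := by
  have he : Monotone fun i : Fin n ↦ (i : ℤ) - (i - s i) := by simpa using hs
  refine ⟨?_⟩
  rintro _ ⟨i, rfl⟩ _ ⟨j, rfl⟩ v ⟨hi, hj⟩
  cases n with
  | zero => exact i.elim0
  | succ n =>
    rcases le_total v 0 with hv | hv
    · refine exists_eq_of_monotone_sub he (Fin.le_last i) hi (hv.trans (sub_nonneg.2 ?_))
      simpa [Int.lt_add_one_iff] using h1 (Fin.last n)
    · refine exists_eq_of_monotone_sub he (Fin.zero_le j) (le_trans ?_ hv) hj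
      simpa using h0 0

theorem sum_sum_abs_sub_of_monotone {s : Fin n → ℤ} (hs : Monotone s) :
    ∑ i, ∑ j, |s i - s j| = 2 * ∑ i : Fin n, (2 * (i : ℤ) - (n - 1)) * s i := by
  induction n with
  | zero => simp
  | succ n ih =>
    have hlast (i : Fin n) : |s i.castSucc - s (Fin.last n)| = s (Fin.last n) - s i.castSucc := by
      rw [abs_sub_comm, abs_of_nonneg (sub_nonneg.2 (hs (Fin.le_last _)))]
    have hinit := ih (hs.comp (Fin.strictMono_castSucc (n := n)).monotone)
    simp only [Function.comp_apply, sub_mul, sum_sub_distrib, ← mul_sum] at hinit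
    simp only [Fin.sum_univ_castSucc, sum_add_distrib, hlast, abs_sub_comm (s (Fin.last n)),
      sub_self, abs_zero, Fin.val_castSucc, Fin.val_last, sum_sub_distrib, sum_const, card_univ,
      Fintype.card_fin, nsmul_eq_mul, sub_mul, ← mul_sum, Nat.cast_add, Nat.cast_one]
    linear_combination hinit

theorem sum_sum_sub_mul_sub (s : Fin n → ℤ) :
    ∑ i : Fin n, ∑ j : Fin n, ((i : ℤ) - j) * (s i - s j) =
      n * ∑ i : Fin n, (2 * (i : ℤ) - (n - 1)) * s i := by
  have hval := two_mul_sum_val n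
  simp only [sub_mul, mul_sub, sum_sub_distrib, ← mul_sum, ← sum_mul, sum_const, card_univ,
    Fintype.card_fin, nsmul_eq_mul, mul_assoc, mul_left_comm _ (n : ℤ)]
  linear_combination -(∑ i, s i) * hval

theorem sum_sum_periodicCut_of_monotone (hn : 0 < n) {s : Fin n → ℤ} (hs : Monotone s)
    (h0 : ∀ i, 0 ≤ s i) (h1 : ∀ i, s i < n) :
    ∑ i, ∑ j, periodicCut n (s i - s j) =
      ∑ i : Fin n, ∑ j : Fin n, (((i : ℤ) - j) ^ 2 - ((i - s i) - (j - s j)) ^ 2) := by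
  have habs (i j) : |s i - s j| ≤ n :=
    abs_sub_le_iff.2 ⟨by linarith [h0 j, h1 i], by linarith [h0 i, h1 j]⟩
  calc ∑ i, ∑ j, periodicCut n (s i - s j)
      = ∑ i, ∑ j, (|s i - s j| * n - (s i - s j) ^ 2) :=
        sum_congr rfl fun i _ ↦ sum_congr rfl fun j _ ↦
          periodicCut_sub_of_le (by exact_mod_cast hn) (habs i j)
    _ = 2 * ∑ i : Fin n, ∑ j : Fin n, ((i : ℤ) - j) * (s i - s j)
          - ∑ i, ∑ j, (s i - s j) ^ 2 := by
        simp only [sum_sub_distrib (s := univ), ← sum_mul, sum_sum_abs_sub_of_monotone hs,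
          sum_sum_sub_mul_sub]
        ring
    _ = _ := by
        simp only [mul_sum, ← sum_sub_distrib]
        exact sum_congr rfl fun i _ ↦ sum_congr rfl fun j _ ↦ by ring

theorem two_mul_periodicCut_sum_le (hn : 0 < n) (x : Fin n → ℤ) :
    2 * (n - 1) * periodicCut n (∑ i, x i) ≤ ∑ i, ∑ j, periodicCut n (x i - x j) := by
  have hn' : (0 : ℤ) < n := by exact_mod_cast hn
  let r : Fin n → ℤ := fun i ↦ x i % n
  let σ := Tuple.sort r
  have h0 (i : Fin n) : 0 ≤ r (σ i) := Int.emod_nonneg _ hn'.ne'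
  have h1 (i : Fin n) : r (σ i) < n := Int.emod_lt_of_pos _ hn'
  have hmono : Monotone (r ∘ σ) := Tuple.monotone_sort r
  have hx (i : Fin n) : x i ≡ r i [ZMOD n] := (Int.mod_modEq _ _).symm
  calc 2 * (n - 1) * periodicCut n (∑ i, x i)
      = 2 * (n - 1) * periodicCut n (∑ i : Fin n, ((i : ℤ) - (i - (r ∘ σ) i))) := by
        simp only [sub_sub_cancel, Function.comp_apply, Equiv.sum_comp σ r]
        rw [periodicCut_congr (Int.ModEq.sum fun i _ ↦ hx i)]
    _ ≤ ∑ i, ∑ j, periodicCut n (r (σ i) - r (σ j)) :=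
        (two_mul_periodicCut_le_of_ordConnected (ordConnected_range_sub hmono h0 h1)).trans_eq
          (sum_sum_periodicCut_of_monotone hn hmono h0 h1).symm
    _ = ∑ i, ∑ j, periodicCut n (r i - r j) := by
        rw [← Equiv.sum_comp σ fun i ↦ ∑ j, periodicCut n (r i - r j)]
        exact sum_congr rfl fun i _ ↦ Equiv.sum_comp σ fun j ↦ periodicCut n (r (σ i) - r j)
    _ = ∑ i, ∑ j, periodicCut n (x i - x j) :=
        sum_congr rfl fun i _ ↦ sum_congr rfl fun j _ ↦
          periodicCut_congr ((hx i).sub (hx j)).symm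

theorem two_mul_periodicCut_sum_le_add {m : ℕ} (hm : 0 < m) (hmn : m ≤ n) (x : Fin n → ℤ) :
    2 * (2 * n - m - 1) * periodicCut m (∑ i, x i) ≤
      ∑ i, ∑ j, periodicCut m (x i - x j) + 2 * (n - m) * ∑ i, periodicCut m (x i) := by
  have hm' : (0 : ℤ) < m := by exact_mod_cast hm
  induction n, hmn using Nat.le_induction with
  | base => simpa [two_mul] using two_mul_periodicCut_sum_le hm x
  | succ n hmn ih =>
    have : (m : ℤ) ≤ n := by exact_mod_cast hmn
    by_cases hx : ∀ i, (m : ℤ) ∣ x i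
    · rw [periodicCut_of_dvd (dvd_sum fun i _ ↦ hx i), mul_zero]
      exact add_nonneg (sum_nonneg fun i _ ↦ sum_nonneg fun j _ ↦ periodicCut_nonneg hm' _)
        (mul_nonneg (by push_cast; linarith) (sum_nonneg fun i _ ↦ periodicCut_nonneg hm' _))
    -- Remove a term `x p` that is not divisible by `m`.
    obtain ⟨p, hp⟩ := not_forall.1 hx
    set y : Fin n → ℤ := fun i ↦ x (p.succAbove i)
    have hgap := periodicCut_le_mul_add_sub (n := 2 * n - m + 1) hm' (by linarith) (∑ i, y i) hp
    have hsub : n * periodicCut m (x p) ≤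
        ∑ i, periodicCut m (y i) + ∑ i, periodicCut m (x p - y i) := by
      rw [← sum_add_distrib]
      refine le_of_eq_of_le (by simp) (sum_le_sum (f := fun _ ↦ periodicCut m (x p)) fun i _ ↦ ?_)
      simpa using periodicCut_add_le hm' (y i) (x p - y i)
    simp only [Fin.sum_univ_succAbove _ p, periodicCut_sub_comm hm' (x (p.succAbove _)) (x p),
      sum_add_distrib, sub_self, periodicCut_of_dvd (dvd_zero _)]
    rw [add_comm (x p)]
    push_cast
    linear_combination ih y + 2 * hsub + 2 * hgap

theorem two_mul_sum_sum_sub {m : ℕ} (hm : 0 < m) {a : Fin n → ℕ} (ha : ∀ s, a s ≤ m) :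
    2 * m * ∑ s, ∑ t, ((a s - a t : ℕ) : ℤ) =
      ∑ s, ∑ t, periodicCut m (a s - a t) + 2 * ((∑ s, (a s : ℤ)) * (n * m - ∑ s, (a s : ℤ)))
        - 2 * n * ∑ s, periodicCut m (a s) := by
  have hm' : (0 : ℤ) < m := by exact_mod_cast hm
  have habs : 2 * ∑ s, ∑ t, ((a s - a t : ℕ) : ℤ) = ∑ s, ∑ t, |(a s : ℤ) - a t| := by
    nth_rw 1 [two_mul, sum_comm]
    simp only [← sum_add_distrib]
    exact sum_congr rfl fun s _ ↦ sum_congr rfl fun t _ ↦ by rw [abs_eq_max_neg]; lia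
  have hle (s t) : |(a s : ℤ) - a t| ≤ m := by
    rw [abs_sub_le_iff]
    have := ha s
    have := ha t
    lia
  have hpair : ∑ s, ∑ t, periodicCut m (a s - a t) =
      (∑ s, ∑ t, |(a s : ℤ) - a t|) * m - ∑ s, ∑ t, ((a s : ℤ) - a t) ^ 2 := by
    simp only [periodicCut_sub_of_le hm' (hle _ _), sum_sub_distrib (s := univ), ← sum_mul]
  have hsq : ∑ s, periodicCut m (a s) = (∑ s, (a s : ℤ)) * m - ∑ s, (a s : ℤ) ^ 2 := by
    rw [sum_mul, ← sum_sub_distrib]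
    refine sum_congr rfl fun s _ ↦ ?_
    rw [periodicCut_of_mem (Nat.cast_nonneg _) (Nat.cast_le.2 (ha s))]
    ring
  rw [hpair, sum_sum_sub_sq, hsq]
  linear_combination m * habs

theorem periodicCut_sum_le {ι : Type*} {m : ℤ} (hm : 0 < m) (s : Finset ι) (x : ι → ℤ) :
    periodicCut m (∑ i ∈ s, x i) ≤ ∑ i ∈ s, periodicCut m (x i) :=
  le_sum_of_subadditive _ (periodicCut_of_dvd (dvd_zero m)).le (periodicCut_add_le hm) s x

section Dvd

variable {m : ℤ} {x : Fin n → ℤ} {s₀ : Fin n}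

theorem sum_modEq_of_dvd (h : ∀ s ≠ s₀, m ∣ x s) : ∑ s, x s ≡ x s₀ [ZMOD m] := by
  rw [← add_sum_erase _ x (mem_univ s₀)]
  have hrest : ∑ s ∈ univ.erase s₀, x s ≡ 0 [ZMOD m] :=
    Int.modEq_zero_iff_dvd.2 (dvd_sum fun s hs ↦ h s (ne_of_mem_erase hs))
  simpa only [add_zero] using hrest.add_left (x s₀)

theorem sum_periodicCut_of_dvd (h : ∀ s ≠ s₀, m ∣ x s) :
    ∑ s, periodicCut m (x s) = periodicCut m (∑ s, x s) := by
  rw [Fintype.sum_eq_single s₀ fun s hs ↦ periodicCut_of_dvd (h s hs),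
    periodicCut_congr (sum_modEq_of_dvd h)]

theorem sum_sum_periodicCut_of_dvd (hm : 0 < m) (h : ∀ s ≠ s₀, m ∣ x s) :
    ∑ s, ∑ t, periodicCut m (x s - x t) = 2 * (n - 1) * periodicCut m (∑ s, x s) := by
  have hmod {s} (hs : s ≠ s₀) : x s₀ - x s ≡ ∑ s, x s [ZMOD m] := by
    simpa using (sum_modEq_of_dvd h).symm.sub (Int.modEq_zero_iff_dvd.2 (h s hs))
  have hcard : ((#(univ.erase s₀) : ℕ) : ℤ) = n - 1 := by
    rw [card_erase_of_mem (mem_univ s₀), card_univ, Fintype.card_fin, Nat.cast_pred s₀.pos]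
  have hrow : ∑ t, periodicCut m (x s₀ - x t) = (n - 1) * periodicCut m (∑ s, x s) := by
    rw [← add_sum_erase _ _ (mem_univ s₀), sub_self, periodicCut_of_dvd (dvd_zero m), zero_add,
      sum_congr rfl fun t ht ↦ periodicCut_congr (hmod (ne_of_mem_erase ht)), sum_const,
      nsmul_eq_mul, hcard]
  have hother (s) (hs : s ∈ univ.erase s₀) :
      ∑ t, periodicCut m (x s - x t) = periodicCut m (∑ s, x s) := by
    have hs := ne_of_mem_erase hs
    rw [Fintype.sum_eq_single s₀ fun t ht ↦ periodicCut_of_dvd ((h s hs).sub (h t ht)),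
      periodicCut_sub_comm hm, periodicCut_congr (hmod hs)]
  rw [← add_sum_erase _ _ (mem_univ s₀), hrow, sum_congr rfl hother, sum_const, nsmul_eq_mul,
    hcard]
  ring

end Dvd

theorem sum_mul_le_sum_mul_of_le_add_one {ι : Type*} {I : Finset ι} {i i₁ : ι}
    {w : ι → ℚ} {a b : ι → ℕ} (hw : ∀ j ∈ I, 0 ≤ w j) (hi₁ : i₁ ∈ I)
    (hi : i ∈ I) (hne : i ≠ i₁) (hwi : w i₁ ≤ w i) (h₁ : a i₁ ≤ b i₁ + 1)
    (hlt : ∀ j ∈ I, j ≠ i₁ → a j < b j) : ∑ j ∈ I, w j * a j ≤ ∑ j ∈ I, w j * b j := by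
  classical
  have hiI : i ∈ I.erase i₁ := mem_erase.2 ⟨hne, hi⟩
  have hrest : ∑ j ∈ (I.erase i₁).erase i, w j * a j ≤ ∑ j ∈ (I.erase i₁).erase i, w j * b j := by
    refine sum_le_sum fun j hj ↦ ?_
    have hj := mem_erase.1 (mem_of_mem_erase hj)
    exact mul_le_mul_of_nonneg_left (Nat.cast_le.2 (hlt j hj.2 hj.1).le) (hw j hj.2)
  have h₁' : w i₁ * a i₁ ≤ w i₁ * (b i₁ + 1) :=
    mul_le_mul_of_nonneg_left (by exact_mod_cast h₁) (hw i₁ hi₁)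
  have hi' : w i * (a i + 1) ≤ w i * b i :=
    mul_le_mul_of_nonneg_left (by exact_mod_cast hlt i hi hne) (hw i hi)
  rw [← add_sum_erase _ _ hi₁, ← add_sum_erase _ _ hi₁, ← add_sum_erase _ _ hiI,
    ← add_sum_erase _ _ hiI]
  linarith

end FinSums

section Grid

variable {ι : Type*} {k : ι → ℕ} {I : Finset ι} {i j : ι}
  {x y z : ∀ i, Fin (k i)} {S : Finset (∀ i, Fin (k i))}

/-- The part of `S` where coordinate `i` has the value `t`. -/
def layer (i : ι) (t : Fin (k i)) (S : Finset (∀ i, Fin (k i))) : Finset (∀ i, Fin (k i)) :=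
  {x ∈ S | x i = t}

theorem mem_layer {t : Fin (k i)} : x ∈ layer i t S ↔ x ∈ S ∧ x i = t := mem_filter

theorem sum_layer {M : Type*} [AddCommMonoid M] (i : ι) (S : Finset (∀ i, Fin (k i)))
    (f : (∀ i, Fin (k i)) → M) : ∑ t, ∑ x ∈ layer i t S, f x = ∑ x ∈ S, f x :=
  sum_fiberwise S (fun x ↦ x i) f

theorem sum_card_layer (i : ι) (S : Finset (∀ i, Fin (k i))) : ∑ t, #(layer i t S) = #S := by
  simp only [card_eq_sum_ones, sum_layer]

variable [DecidableEq ι] [Fintype ι]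

/-- The points of the grid that agree with `z` outside the coordinates in `I`. -/
def subgrid (I : Finset ι) (z : ∀ i, Fin (k i)) : Finset (∀ i, Fin (k i)) :=
  {x | ∀ i ∉ I, x i = z i}

theorem mem_subgrid : x ∈ subgrid I z ↔ ∀ i ∉ I, x i = z i := by simp [subgrid]

theorem update_mem_subgrid (hx : x ∈ subgrid I z) (hi : i ∈ I) (t : Fin (k i)) :
    update x i t ∈ subgrid I z :=
  mem_subgrid.2 fun j hj ↦ by
    rw [update_of_ne (ne_of_mem_of_not_mem hi hj).symm, mem_subgrid.1 hx j hj]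

theorem mem_subgrid_erase (hi : i ∈ I) {t : Fin (k i)} :
    x ∈ subgrid (I.erase i) (update z i t) ↔ x ∈ subgrid I z ∧ x i = t := by
  refine ⟨fun h ↦ ⟨mem_subgrid.2 fun j hj ↦ ?_, ?_⟩, ?_⟩
  · rw [mem_subgrid.1 h j (mt mem_of_mem_erase hj), update_of_ne (ne_of_mem_of_not_mem hi hj).symm]
  · rw [mem_subgrid.1 h i (notMem_erase i I), update_self]
  · rintro ⟨h, rfl⟩
    refine mem_subgrid.2 fun j hj ↦ ?_
    obtain rfl | hji := eq_or_ne j i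
    · rw [update_self]
    · rw [update_of_ne hji, mem_subgrid.1 h j fun hjI ↦ hj (mem_erase.2 ⟨hji, hjI⟩)]

theorem subgrid_singleton (hx : x ∈ subgrid {i} z) : subgrid {i} z = univ.image (update x i) := by
  ext y
  refine ⟨fun hy ↦ mem_image.2 ⟨y i, mem_univ _, funext fun j ↦ ?_⟩, fun hy ↦ ?_⟩
  · obtain rfl | hj := eq_or_ne j i
    · rw [update_self]
    · have hj : j ∉ ({i} : Finset ι) := mt mem_singleton.1 hj
      rw [update_of_ne (mt mem_singleton.2 hj), mem_subgrid.1 hx j hj, mem_subgrid.1 hy j hj]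
  · obtain ⟨t, -, rfl⟩ := mem_image.1 hy
    exact update_mem_subgrid hx (mem_singleton_self i) t

theorem card_subgrid_singleton (i : ι) (z : ∀ i, Fin (k i)) : #(subgrid {i} z) = k i := by
  rw [subgrid_singleton (mem_subgrid.2 fun _ _ ↦ rfl : z ∈ subgrid {i} z),
    card_image_of_injective _ (update_injective z i), card_univ, Fintype.card_fin]

theorem layer_subset_subgrid (hi : i ∈ I) (hS : S ⊆ subgrid I z) (t : Fin (k i)) :
    layer i t S ⊆ subgrid (I.erase i) (update z i t) := fun _ hx ↦
  (mem_subgrid_erase hi).2 ⟨hS (mem_layer.1 hx).1, (mem_layer.1 hx).2⟩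

theorem mem_image_layer {s t : Fin (k i)} :
    x ∈ (layer i t S).image (update · i s) ↔ x i = s ∧ update x i t ∈ S := by
  refine mem_image.trans ⟨?_, fun ⟨hs, ht⟩ ↦ ⟨update x i t, mem_layer.2 ⟨ht, update_self ..⟩, ?_⟩⟩
  · rintro ⟨y, hy, rfl⟩
    obtain ⟨hyS, rfl⟩ := mem_layer.1 hy
    simpa using hyS
  · rw [update_idem, ← hs, update_eq_self]

theorem card_image_layer (s t : Fin (k i)) (S : Finset (∀ i, Fin (k i))) :
    #((layer i t S).image (update · i s)) = #(layer i t S) := by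
  refine card_image_of_injOn fun x hx y hy hxy ↦ ?_
  rw [← update_eq_self i x, ← update_eq_self i y, (mem_layer.1 hx).2, (mem_layer.1 hy).2]
  simpa using congrArg (update · i t) hxy

/-- The number of edges in direction `i` that leave `S` in the product of the complete graphs on
`Fin (k i)`: pairs of a point in `S` and a point outside `S` that differ in coordinate `i` only. -/
def cutDir (i : ι) (S : Finset (∀ i, Fin (k i))) : ℕ := ∑ x ∈ S, #{t | update x i t ∉ S}

/-- The sum of the cuts of `S` in the directions of `I`, direction `i` having weight `w i`. -/
def weightedCut (w : ι → ℚ) (I : Finset ι) (S : Finset (∀ i, Fin (k i))) : ℚ :=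
  ∑ i ∈ I, w i * cutDir i S

theorem cutDir_eq_sum_layer (hij : i ≠ j) (S : Finset (∀ i, Fin (k i))) :
    cutDir j S = ∑ t, cutDir j (layer i t S) := by
  rw [cutDir, ← sum_layer i S]
  refine sum_congr rfl fun t _ ↦ sum_congr rfl fun x hx ↦ ?_
  simp [mem_layer, update_of_ne hij, (mem_layer.1 hx).2]

theorem weightedCut_eq_add_sum_layer (w : ι → ℚ) (hi : i ∈ I) (S : Finset (∀ i, Fin (k i))) :
    weightedCut w I S = w i * cutDir i S + ∑ t, weightedCut w (I.erase i) (layer i t S) := by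
  simp only [weightedCut]
  rw [← add_sum_erase _ _ hi, sum_comm]
  congr 1
  refine sum_congr rfl fun j hj ↦ ?_
  rw [cutDir_eq_sum_layer (ne_of_mem_erase hj).symm S, Nat.cast_sum, mul_sum]

theorem cutDir_eq_sum_card_sdiff (i : ι) (S : Finset (∀ i, Fin (k i))) :
    cutDir i S = ∑ s, ∑ t, #(layer i s S \ (layer i t S).image (update · i s)) := by
  rw [cutDir, ← sum_layer i S]
  refine sum_congr rfl fun s _ ↦ ?_
  simp only [card_filter]
  rw [sum_comm]
  refine sum_congr rfl fun t _ ↦ ?_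
  rw [← card_filter]
  congr 1
  ext x
  simp only [mem_filter, mem_sdiff, mem_image_layer, not_and]
  exact and_congr_right fun hx ↦ ⟨fun h _ ↦ h, fun h ↦ h (mem_layer.1 hx).2⟩

theorem sum_card_layer_sub_le_cutDir (i : ι) (S : Finset (∀ i, Fin (k i))) :
    ∑ s, ∑ t, (#(layer i s S) - #(layer i t S)) ≤ cutDir i S := by
  rw [cutDir_eq_sum_card_sdiff]
  gcongr with s _ t _
  rw [← card_image_layer s t]
  exact le_card_sdiff _ _

theorem cutDir_of_subset_subgrid_singleton (hS : S ⊆ subgrid {i} z) :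
    cutDir i S = #S * (k i - #S) := by
  rw [cutDir, ← smul_eq_mul, ← sum_const]
  refine sum_congr rfl fun x hx ↦ ?_
  have hSx : ({t | update x i t ∈ S} : Finset (Fin (k i))).image (update x i) = S := by
    rw [← filter_image (p := (· ∈ S)), ← subgrid_singleton (hS hx), filter_mem_eq_inter,
      inter_eq_right.2 hS]
  rw [← compl_filter, card_compl, Fintype.card_fin, ← card_image_of_injective _
    (update_injective x i), hSx]

/-- The set with the prescribed layers `T t` in direction `i`. -/
def ofLayers (i : ι) (T : Fin (k i) → Finset (∀ i, Fin (k i))) : Finset (∀ i, Fin (k i)) :=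
  {x | x ∈ T (x i)}

theorem mem_ofLayers {T : Fin (k i) → Finset (∀ i, Fin (k i))} :
    x ∈ ofLayers i T ↔ x ∈ T (x i) := by simp [ofLayers]

theorem layer_ofLayers {T : Fin (k i) → Finset (∀ i, Fin (k i))}
    (hT : ∀ t, ∀ x ∈ T t, x i = t) (t : Fin (k i)) : layer i t (ofLayers i T) = T t := by
  ext x
  rw [mem_layer, mem_ofLayers]
  exact ⟨fun ⟨h, hxt⟩ ↦ hxt ▸ h, fun h ↦ by rw [hT t x h]; exact ⟨h, rfl⟩⟩

/-- `S` is closed under lowering a coordinate in `I`. -/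
def CoordClosed (I : Finset ι) (S : Finset (∀ i, Fin (k i))) : Prop :=
  ∀ i ∈ I, ∀ x ∈ S, ∀ t ≤ x i, update x i t ∈ S

theorem card_filter_update_notMem (hS : ∀ x ∈ S, ∀ t ≤ x i, update x i t ∈ S) (hx : x ∈ S) :
    #{t | update x i t ∉ S} + #{t ∈ Ioi (x i) | update x i t ∈ S} + x i + 1 = k i := by
  have hIoi : ({t | update x i t ∉ S} : Finset (Fin (k i))) =
      {t ∈ Ioi (x i) | update x i t ∉ S} := by
    ext t
    simp only [mem_filter, mem_univ, true_and, mem_Ioi]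
    exact ⟨fun h ↦ ⟨not_le.1 fun ht ↦ h (hS x hx t ht), h⟩, And.right⟩
  have hsplit := card_filter_add_card_filter_not (s := Ioi (x i)) (update x i · ∈ S)
  rw [Fin.card_Ioi] at hsplit
  rw [hIoi]
  lia

theorem sum_card_filter_Ioi_update_mem (hS : ∀ x ∈ S, ∀ t ≤ x i, update x i t ∈ S) :
    ∑ x ∈ S, #{t ∈ Ioi (x i) | update x i t ∈ S} = ∑ x ∈ S, (x i : ℕ) := by
  have hIio (x) (hx : x ∈ S) : (x i : ℕ) = #{t ∈ Iio (x i) | update x i t ∈ S} := by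
    rw [filter_true_of_mem fun t ht ↦ hS x hx t (mem_Iio.1 ht).le, Fin.card_Iio]
  rw [sum_congr rfl hIio, ← card_sigma, ← card_sigma]
  -- Exchange the old and the new value of coordinate `i`.
  refine card_bij' (fun p _ ↦ ⟨update p.1 i p.2, p.1 i⟩) (fun p _ ↦ ⟨update p.1 i p.2, p.1 i⟩)
    ?_ ?_ ?_ ?_ <;> simp +contextual

theorem cutDir_eq_of_closed (hS : ∀ x ∈ S, ∀ t ≤ x i, update x i t ∈ S) :
    (cutDir i S : ℚ) = ∑ x ∈ S, ((k i : ℚ) - 1 - 2 * (x i : ℕ)) := by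
  have hcard := sum_congr rfl fun x hx ↦ card_filter_update_notMem hS hx
  rw [sum_add_distrib, sum_add_distrib, sum_add_distrib, sum_card_filter_Ioi_update_mem hS,
    ← cutDir, sum_const, sum_const, smul_eq_mul, smul_eq_mul] at hcard
  rw [sum_sub_distrib, ← mul_sum, sum_const, nsmul_eq_mul]
  have hcard' : (cutDir i S : ℚ) + ∑ x ∈ S, ((x i : ℕ) : ℚ) + ∑ x ∈ S, ((x i : ℕ) : ℚ) + #S * 1 =
      #S * k i := by exact_mod_cast hcard
  linarith

theorem CoordClosed.weightedCut_eq (w : ι → ℚ) (hS : CoordClosed I S) :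
    weightedCut w I S = ∑ x ∈ S, ∑ i ∈ I, w i * ((k i : ℚ) - 1 - 2 * (x i : ℕ)) := by
  rw [sum_comm, weightedCut]
  exact sum_congr rfl fun i hi ↦ by rw [cutDir_eq_of_closed (hS i hi), mul_sum]

theorem CoordClosed.weightedCut_insert_erase_le (w : ι → ℚ) (hS : CoordClosed I S)
    (hS' : CoordClosed I (insert x (S.erase y))) (hx : x ∉ S) (hy : y ∈ S)
    (hxy : ∑ i ∈ I, w i * (y i : ℕ) ≤ ∑ i ∈ I, w i * (x i : ℕ)) :
    weightedCut w I (insert x (S.erase y)) ≤ weightedCut w I S := by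
  rw [hS'.weightedCut_eq, hS.weightedCut_eq, sum_insert (mt mem_of_mem_erase hx),
    ← add_sum_erase S _ hy]
  simp only [mul_sub, mul_left_comm _ (2 : ℚ), sum_sub_distrib, ← mul_sum]
  linarith

end Grid

section Lex

variable {ι : Type*} [LinearOrder ι] {k : ι → ℕ} {I : Finset ι} {i j : ι}
  {x y z : ∀ i, Fin (k i)} {B S T U : Finset (∀ i, Fin (k i))}

theorem toLex_lt_iff : toLex x < toLex y ↔ ∃ i, (∀ j < i, x j = y j) ∧ x i < y i := Iff.rfl

theorem toLex_update_lt_update (h : x i = y i) (t : Fin (k i)) (hxy : toLex x < toLex y) :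
    toLex (update x i t) < toLex (update y i t) := by
  obtain ⟨j, hj, hlt⟩ := toLex_lt_iff.1 hxy
  have hji : j ≠ i := fun hji ↦ hlt.ne (hji ▸ h)
  refine toLex_lt_iff.2 ⟨j, fun l hl ↦ ?_, by rwa [update_of_ne hji, update_of_ne hji]⟩
  obtain rfl | hli := eq_or_ne l i
  · rw [update_self, update_self]
  · rw [update_of_ne hli, update_of_ne hli, hj l hl]

/-- `T` is an initial segment of `B` in the lexicographic order. -/
def LexInitial (B T : Finset (∀ i, Fin (k i))) : Prop :=
  T ⊆ B ∧ ∀ x ∈ T, ∀ y ∈ B, toLex y < toLex x → y ∈ T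

section WellFounded

variable [WellFoundedLT ι]

theorem toLex_update_lt_self {t : Fin (k i)} (h : t < x i) : toLex (update x i t) < toLex x :=
  Pi.toLex_update_lt_self_iff.2 h

theorem LexInitial.subset_of_card_le (hT : LexInitial B T) (hU : LexInitial B U)
    (h : #T ≤ #U) : T ⊆ U := by
  by_contra hTU
  obtain ⟨x, hxT, hxU⟩ := not_subset.1 hTU
  have hUT : U ⊆ T := fun y hy ↦ by
    obtain hlt | heq | hgt := lt_trichotomy (toLex y) (toLex x)
    · exact hT.2 x hxT y (hU.1 hy) hlt
    · rwa [toLex_inj.1 heq]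
    · exact absurd (hU.2 y hy x (hT.1 hxT) hgt) hxU
  exact hTU (eq_of_subset_of_card_le hUT h).ge

theorem LexInitial.eq_of_card_eq (hT : LexInitial B T) (hU : LexInitial B U)
    (h : #T = #U) : T = U :=
  eq_of_subset_of_card_le (hT.subset_of_card_le hU h.le) h.ge

theorem exists_lexInitial (B : Finset (∀ i, Fin (k i))) {n : ℕ} (hn : n ≤ #B) :
    ∃ T, LexInitial B T ∧ #T = n := by
  classical
  induction n with
  | zero => exact ⟨∅, ⟨empty_subset B, by simp⟩, card_empty⟩
  | succ n ih =>
    obtain ⟨T, hT, rfl⟩ := ih (Nat.le_of_succ_le hn)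
    have hne : (B \ T).Nonempty := sdiff_nonempty.2 fun hBT ↦ (card_le_card hBT).not_gt hn
    obtain ⟨x, hx, hmin⟩ := exists_min_image (B \ T) toLex hne
    obtain ⟨hxB, hxT⟩ := mem_sdiff.1 hx
    refine ⟨insert x T, ⟨insert_subset hxB hT.1, fun y hy v hv hvy ↦ mem_insert_of_mem ?_⟩,
      card_insert_of_notMem hxT⟩
    obtain rfl | hy := mem_insert.1 hy
    · by_contra hvT
      exact (hmin v (mem_sdiff.2 ⟨hv, hvT⟩)).not_gt hvy
    · exact hT.2 y hy v hv hvy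

theorem exists_lt_of_not_lexInitial (hS : S ⊆ B) (hn : ¬ LexInitial B S) :
    ∃ x ∈ B, x ∉ S ∧ ∃ y ∈ S, toLex x < toLex y ∧
      (∀ v ∈ B, v ∉ S → toLex x ≤ toLex v) ∧ ∀ v ∈ S, toLex v ≤ toLex y := by
  classical
  obtain ⟨v, hv, u, hu, huv, huS⟩ :
      ∃ v ∈ S, ∃ u ∈ B, toLex u < toLex v ∧ u ∉ S := by
    simpa only [LexInitial, hS, true_and, not_forall, exists_prop] using hn
  obtain ⟨x, hx, hxmin⟩ := exists_min_image (B \ S) toLex ⟨u, mem_sdiff.2 ⟨hu, huS⟩⟩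
  obtain ⟨y, hy, hymax⟩ := exists_max_image S toLex ⟨v, hv⟩
  have hmin (v) (hvB : v ∈ B) (hvS : v ∉ S) := hxmin v (mem_sdiff.2 ⟨hvB, hvS⟩)
  exact ⟨x, (mem_sdiff.1 hx).1, (mem_sdiff.1 hx).2, y, hy,
    ((hmin u hu huS).trans_lt huv).trans_le (hymax v hv), hmin, hymax⟩

end WellFounded

variable [Fintype ι]

open Classical in
/-- The number of points below `x` in the lexicographic order. -/
noncomputable def lexRank (x : ∀ i, Fin (k i)) : ℕ := #{y | toLex y < toLex x}

theorem lexRank_lt_lexRank (h : toLex x < toLex y) : lexRank x < lexRank y := by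
  classical
  refine card_lt_card ((ssubset_iff_of_subset fun v hv ↦ ?_).2 ⟨x, ?_, ?_⟩)
  · simp only [mem_filter, mem_univ, true_and] at hv ⊢
    exact hv.trans h
  · simpa only [mem_filter, mem_univ, true_and] using h
  · simp only [mem_filter, mem_univ, true_and]
    exact lt_irrefl _

theorem LexInitial.sum_lexRank_lt (hT : LexInitial B T) (hS : S ⊆ B) (h : #S = #T)
    (hne : S ≠ T) : ∑ x ∈ T, lexRank x < ∑ x ∈ S, lexRank x := by
  have hpos : (T \ S).Nonempty :=
    sdiff_nonempty.2 fun hTS ↦ hne (eq_of_subset_of_card_le hTS h.le).symm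
  obtain ⟨m, hm, hmax⟩ := exists_max_image (T \ S) lexRank hpos
  obtain ⟨hmT, hmS⟩ := mem_sdiff.1 hm
  have hlt (x) (hx : x ∈ S \ T) : lexRank m + 1 ≤ lexRank x := by
    obtain ⟨hxS, hxT⟩ := mem_sdiff.1 hx
    refine lexRank_lt_lexRank ((lt_trichotomy (toLex m) (toLex x)).resolve_right ?_)
    rintro (heq | hgt)
    · exact hmS (toLex_inj.1 heq ▸ hxS)
    · exact hxT (hT.2 m hmT x (hS hxS) hgt)
  have hsum : ∑ x ∈ T \ S, lexRank x < ∑ x ∈ S \ T, lexRank x :=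
    calc ∑ x ∈ T \ S, lexRank x ≤ #(T \ S) * lexRank m := sum_le_card_nsmul _ _ _ hmax
      _ < #(T \ S) * (lexRank m + 1) := by have := hpos.card_pos; gcongr; exact Nat.lt_succ_self _
      _ = #(S \ T) * (lexRank m + 1) := by rw [card_sdiff_comm h]
      _ ≤ ∑ x ∈ S \ T, lexRank x := card_nsmul_le_sum _ _ _ hlt
  rw [← sum_inter_add_sum_sdiff T S, ← sum_inter_add_sum_sdiff S T, inter_comm S]
  exact Nat.add_lt_add_left hsum _

theorem LexInitial.image_update (hi : i ∈ I) {s t : Fin (k i)}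
    (h : LexInitial (subgrid (I.erase i) (update z i t)) (layer i t S)) :
    LexInitial (subgrid (I.erase i) (update z i s)) ((layer i t S).image (update · i s)) := by
  refine ⟨fun x hx ↦ ?_, fun x hx y hy hyx ↦ ?_⟩
  · obtain ⟨y, hy, rfl⟩ := mem_image.1 hx
    exact (mem_subgrid_erase hi).2
      ⟨update_mem_subgrid ((mem_subgrid_erase hi).1 (h.1 hy)).1 hi s, update_self ..⟩
  · obtain ⟨hys, hyi⟩ := (mem_subgrid_erase hi).1 hy
    obtain ⟨hxi, hxS⟩ := mem_image_layer.1 hx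
    refine mem_image_layer.2 ⟨hyi, (mem_layer.1 (h.2 _ (mem_layer.2 ⟨hxS, update_self ..⟩) _
      ((mem_subgrid_erase hi).2 ⟨update_mem_subgrid hys hi t, update_self ..⟩)
      (toLex_update_lt_update (hyi.trans hxi.symm) t hyx))).1⟩

/-- Every layer of `S` in a direction of `I` is a lexicographic initial segment of the
corresponding layer of `subgrid I z`. -/
def LayersLexInitial (I : Finset ι) (z : ∀ i, Fin (k i)) (i : ι)
    (S : Finset (∀ i, Fin (k i))) : Prop :=
  ∀ t, LexInitial (subgrid (I.erase i) (update z i t)) (layer i t S)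

theorem LayersLexInitial.cutDir_eq (hi : i ∈ I) (hS : LayersLexInitial I z i S) :
    cutDir i S = ∑ s, ∑ t, (#(layer i s S) - #(layer i t S)) := by
  rw [cutDir_eq_sum_card_sdiff]
  refine sum_congr rfl fun s _ ↦ sum_congr rfl fun t _ ↦ ?_
  have hshift := (hS t).image_update hi (s := s)
  rw [← card_image_layer s t]
  obtain h | h := le_total #(layer i s S) #((layer i t S).image (update · i s))
  · rw [Nat.sub_eq_zero_of_le h, card_eq_zero, sdiff_eq_empty_iff_subset]
    exact (hS s).subset_of_card_le hshift h
  · exact card_sdiff_of_subset (hshift.subset_of_card_le (hS s) h)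

/-- Lexicographic initial segments of `subgrid I z` minimise the weighted cut among the subsets of
the same size. -/
def LexOptimal (w : ι → ℚ) (I : Finset ι) (z : ∀ i, Fin (k i)) : Prop :=
  ∀ ⦃T⦄, LexInitial (subgrid I z) T → ∀ S ⊆ subgrid I z, #S = #T →
    weightedCut w I T ≤ weightedCut w I S

/-- Some subset of `subgrid I z` of the size of `S` has no larger weighted cut and lies lower in
the lexicographic order, as measured by the sum of the ranks of its points. -/
def LexImprovable (w : ι → ℚ) (I : Finset ι) (z : ∀ i, Fin (k i))
    (S : Finset (∀ i, Fin (k i))) : Prop :=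
  ∃ S' ⊆ subgrid I z, #S' = #S ∧ weightedCut w I S' ≤ weightedCut w I S ∧
    ∑ x ∈ S', lexRank x < ∑ x ∈ S, lexRank x

theorem lexImprovable_of_not_layersLexInitial {w : ι → ℚ} (hi : i ∈ I) (hw : 0 ≤ w i)
    (ih : ∀ t, LexOptimal w (I.erase i) (update z i t)) (hS : S ⊆ subgrid I z)
    (hn : ¬ LayersLexInitial I z i S) : LexImprovable w I z S := by
  have hex (t) : ∃ T, LexInitial (subgrid (I.erase i) (update z i t)) T ∧ #T = #(layer i t S) :=
    exists_lexInitial _ (card_le_card (layer_subset_subgrid hi hS t))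
  choose T hT hcard using hex
  have hTi (t) (x) (hx : x ∈ T t) : x ∈ subgrid I z ∧ x i = t :=
    (mem_subgrid_erase hi).1 ((hT t).1 hx)
  have hlayer (t) : layer i t (ofLayers i T) = T t := layer_ofLayers (fun t x hx ↦ (hTi t x hx).2) t
  refine ⟨ofLayers i T, fun x hx ↦ (hTi _ x (mem_ofLayers.1 hx)).1, ?_, ?_, ?_⟩
  · rw [← sum_card_layer i, ← sum_card_layer i S]
    simp only [hlayer, hcard]
  · rw [weightedCut_eq_add_sum_layer w hi, weightedCut_eq_add_sum_layer w hi]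
    have hcut : cutDir i (ofLayers i T) ≤ cutDir i S := by
      rw [LayersLexInitial.cutDir_eq hi fun t ↦ (hlayer t).symm ▸ hT t]
      simpa only [hlayer, hcard] using sum_card_layer_sub_le_cutDir i S
    gcongr with t
    rw [hlayer]
    exact ih t (hT t) _ (layer_subset_subgrid hi hS t) (hcard t).symm
  · rw [← sum_layer i, ← sum_layer i S]
    simp only [hlayer]
    obtain ⟨t, ht⟩ := not_forall.1 hn
    have hlt (s) (hs : layer i s S ≠ T s) :=
      (hT s).sum_lexRank_lt (layer_subset_subgrid hi hS s) (hcard s).symm hs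
    refine sum_lt_sum (fun s _ ↦ ?_) ⟨t, mem_univ t, hlt t fun h ↦ ht (h ▸ hT t)⟩
    obtain h | h := eq_or_ne (layer i s S) (T s)
    · rw [h]
    · exact (hlt s h).le

section Swap

variable {i₁ : ι}

theorem LayersLexInitial.subset (hi : i ∈ I) (hS : LayersLexInitial I z i S) :
    S ⊆ subgrid I z := fun x hx ↦
  ((mem_subgrid_erase hi).1 ((hS (x i)).1 (mem_layer.2 ⟨hx, rfl⟩))).1

theorem LayersLexInitial.mem_of_lt (hi : i ∈ I) (hS : LayersLexInitial I z i S) (hx : x ∈ S)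
    (hy : y ∈ subgrid I z) (hyx : y i = x i) (hlt : toLex y < toLex x) : y ∈ S :=
  (mem_layer.1 ((hS (x i)).2 x (mem_layer.2 ⟨hx, rfl⟩) y ((mem_subgrid_erase hi).2 ⟨hy, hyx⟩)
    hlt)).1

theorem coordClosed_of_layersLexInitial (hI : 1 < #I) (hS : ∀ i ∈ I, LayersLexInitial I z i S) :
    CoordClosed I S := fun i hi x hx t ht ↦ by
  obtain rfl | ht := ht.eq_or_lt
  · rwa [update_eq_self]
  obtain ⟨j, hj, hji⟩ := exists_mem_ne hI i
  exact (hS j hj).mem_of_lt hj hx (update_mem_subgrid ((hS j hj).subset hj hx) hi t)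
    (update_of_ne hji ..) (toLex_update_lt_self ht)

theorem update_mem_of_lt (hS : LayersLexInitial I z j S) (hcl : CoordClosed I S) (hj : j ∈ I)
    (hij : i₁ < j) (hx : x ∈ subgrid I z) (hy : y ∈ S) (heq : ∀ l < i₁, x l = y l)
    (hlt : x i₁ < y i₁) {t : Fin (k j)} (ht : t ≤ y j) : update x j t ∈ S := by
  refine hS.mem_of_lt hj (hcl j hj y hy t ht) (update_mem_subgrid hx hj t)
    (by rw [update_self, update_self]) (toLex_lt_iff.2 ⟨i₁, fun l hl ↦ ?_, ?_⟩)
  · rw [update_of_ne (hl.trans hij).ne, update_of_ne (hl.trans hij).ne, heq l hl]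
  · rwa [update_of_ne hij.ne, update_of_ne hij.ne]

theorem lt_of_notMem_of_lt (hS : LayersLexInitial I z j S) (hcl : CoordClosed I S) (hj : j ∈ I)
    (hij : i₁ < j) (hx : x ∈ subgrid I z) (hxS : x ∉ S) (hy : y ∈ S) (heq : ∀ l < i₁, x l = y l)
    (hlt : x i₁ < y i₁) : y j < x j := by
  by_contra! h
  exact hxS (by simpa using update_mem_of_lt hS hcl hj hij hx hy heq hlt h)

theorem le_add_one_of_notMem (hS : ∀ i ∈ I, LayersLexInitial I z i S) (hcl : CoordClosed I S)
    (hi₁ : i₁ ∈ I) (hi : i ∈ I) (hj : j ∈ I) (hii : i ≠ i₁) (hij : i ≠ j) (hj₁ : i₁ < j)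
    (hx : x ∈ subgrid I z) (hxS : x ∉ S) (hy : y ∈ S) (heq : ∀ l < i₁, x l = y l) :
    (y i₁ : ℕ) ≤ x i₁ + 1 := by
  by_contra! h
  -- Raise `x` by one at `i₁` and set its coordinate `j` to that of `y`.
  obtain ⟨a, ha⟩ : ∃ a : Fin (k i₁), (a : ℕ) = x i₁ + 1 := ⟨⟨x i₁ + 1, h.trans (y i₁).2⟩, rfl⟩
  have hmem : update (update x i₁ a) j (y j) ∈ S :=
    update_mem_of_lt (hS j hj) hcl hj hj₁ (update_mem_subgrid hx hi₁ a) hy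
      (fun l hl ↦ by rw [update_of_ne hl.ne, heq l hl])
      (by rwa [update_self, Fin.lt_def, ha]) le_rfl
  refine hxS ((hS i hi).mem_of_lt hi hmem hx ?_ (toLex_lt_iff.2 ⟨i₁, fun l hl ↦ ?_, ?_⟩))
  · rw [update_of_ne hij, update_of_ne hii]
  · rw [update_of_ne (hl.trans hj₁).ne, update_of_ne hl.ne]
  · rw [update_of_ne hj₁.ne, update_self, Fin.lt_def, ha]
    exact Nat.lt_succ_self _

theorem CoordClosed.insert_erase (hS : CoordClosed I S) (hx : x ∈ subgrid I z)
    (hxmin : ∀ v ∈ subgrid I z, v ∉ S → toLex x ≤ toLex v) (hymax : ∀ v ∈ S, toLex v ≤ toLex y)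
    (hxy : toLex x < toLex y) : CoordClosed I (insert x (S.erase y)) := by
  intro i hi v hv t ht
  obtain rfl | ht := ht.eq_or_lt
  · rwa [update_eq_self]
  have hlt : toLex (update v i t) < toLex v := toLex_update_lt_self ht
  refine mem_insert_of_mem (mem_erase.2 ?_)
  obtain rfl | hv := mem_insert.1 hv
  · refine ⟨fun h ↦ (h ▸ hlt).asymm hxy, ?_⟩
    by_contra hvS
    exact (hxmin _ (update_mem_subgrid hx hi t) hvS).not_gt hlt
  · have hvS := mem_of_mem_erase hv
    exact ⟨fun h ↦ (hymax v hvS).not_gt (h ▸ hlt), hS i hi v hvS t ht.le⟩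

theorem exists_first_ne (hI : 1 < #I) (hS : ∀ i ∈ I, LayersLexInitial I z i S)
    (hx : x ∈ subgrid I z) (hxS : x ∉ S) (hy : y ∈ S) (hxy : toLex x < toLex y) :
    ∃ i₁ ∈ I, (∀ l < i₁, x l = y l) ∧ x i₁ < y i₁ ∧ ∀ j ∈ I, j ≠ i₁ → i₁ < j := by
  have hne (j) (hj : j ∈ I) : x j ≠ y j := fun h ↦ hxS ((hS j hj).mem_of_lt hj hy hx h hxy)
  obtain ⟨i₁, heq, hlt⟩ := toLex_lt_iff.1 hxy
  obtain ⟨i, hi⟩ := card_pos.1 (zero_lt_one.trans hI)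
  refine ⟨i₁, ?_, heq, hlt, fun j hj hj₁ ↦ ?_⟩
  · by_contra hi₁
    exact hlt.ne ((mem_subgrid.1 hx i₁ hi₁).trans
      (mem_subgrid.1 ((hS i hi).subset hi hy) i₁ hi₁).symm)
  · exact lt_of_le_of_ne (not_lt.1 fun h ↦ hne j hj (heq j h)) hj₁.symm

theorem lexImprovable_of_layersLexInitial {w : ι → ℚ} (hI : 2 < #I) (hw : ∀ i ∈ I, 0 ≤ w i)
    (hmono : ∀ i ∈ I, ∀ j ∈ I, i < j → w i ≤ w j) (hS : ∀ i ∈ I, LayersLexInitial I z i S)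
    (hn : ¬ LexInitial (subgrid I z) S) : LexImprovable w I z S := by
  have hI' : 1 < #I := Nat.lt_of_succ_lt hI
  have hcl := coordClosed_of_layersLexInitial hI' hS
  obtain ⟨i, hi⟩ := card_pos.1 (zero_lt_one.trans hI')
  have hSz := (hS i hi).subset hi
  obtain ⟨x, hx, hxS, y, hy, hxy, hxmin, hymax⟩ := exists_lt_of_not_lexInitial hSz hn
  obtain ⟨i₁, hi₁, heq, hlt, hfirst⟩ := exists_first_ne hI' hS hx hxS hy hxy
  obtain ⟨i, hi, j, hj, hij⟩ := one_lt_card.1 (by rw [card_erase_of_mem hi₁]; lia :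
    1 < #(I.erase i₁))
  obtain ⟨hi₁', hi⟩ := mem_erase.1 hi
  obtain ⟨hj₁, hj⟩ := mem_erase.1 hj
  have hsum : ∑ l ∈ I, w l * (y l : ℕ) ≤ ∑ l ∈ I, w l * (x l : ℕ) :=
    sum_mul_le_sum_mul_of_le_add_one hw hi₁ hi hi₁' (hmono i₁ hi₁ i hi (hfirst i hi hi₁'))
      (le_add_one_of_notMem hS hcl hi₁ hi hj hi₁' hij (hfirst j hj hj₁) hx hxS hy heq)
      fun l hl hl₁ ↦ lt_of_notMem_of_lt (hS l hl) hcl hl (hfirst l hl hl₁) hx hxS hy heq hlt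
  have hx' : x ∉ S.erase y := mt mem_of_mem_erase hxS
  refine ⟨insert x (S.erase y), insert_subset hx ((erase_subset y S).trans hSz), ?_,
    hcl.weightedCut_insert_erase_le w (hcl.insert_erase hx hxmin hymax hxy) hxS hy hsum, ?_⟩
  · rw [card_insert_of_notMem hx', card_erase_add_one hy]
  · rw [sum_insert hx', ← add_sum_erase S lexRank hy]
    exact Nat.add_lt_add_right (lexRank_lt_lexRank hxy) _

end Swap

end Lex

section Pair

variable {ι : Type*} [LinearOrder ι] [Fintype ι] {k : ι → ℕ} {I : Finset ι} {i j : ι}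
  {x y z : ∀ i, Fin (k i)} {S T : Finset (∀ i, Fin (k i))}

theorem LexInitial.layersLexInitial (hi : i ∈ I) (hT : LexInitial (subgrid I z) T) :
    LayersLexInitial I z i T := fun t ↦
  ⟨layer_subset_subgrid hi hT.1 t, fun x hx y hy hyx ↦ by
    obtain ⟨hy, hyt⟩ := (mem_subgrid_erase hi).1 hy
    exact mem_layer.2 ⟨hT.2 x (mem_layer.1 hx).1 y hy hyx, hyt⟩⟩

theorem LexInitial.mem_of_apply_lt (hT : LexInitial (subgrid I z) T) (hi : ∀ j ∈ I, i ≤ j)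
    (hx : x ∈ T) (hy : y ∈ subgrid I z) (hyx : y i < x i) : y ∈ T := by
  refine hT.2 x hx y hy (toLex_lt_iff.2 ⟨i, fun l hl ↦ ?_, hyx⟩)
  have hlI : l ∉ I := fun hlI ↦ (hi l hlI).not_gt hl
  rw [mem_subgrid.1 hy l hlI, mem_subgrid.1 (hT.1 hx) l hlI]

theorem layer_subset_subgrid_singleton (hij : i ≠ j) (hS : S ⊆ subgrid {i, j} z) (t : Fin (k i)) :
    layer i t S ⊆ subgrid {j} (update z i t) := by
  have := layer_subset_subgrid (mem_insert_self i {j}) hS t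
  rwa [erase_insert (mt mem_singleton.1 hij)] at this

theorem card_layer_le (hij : i ≠ j) (hS : S ⊆ subgrid {i, j} z) (t : Fin (k i)) :
    #(layer i t S) ≤ k j := by
  rw [← card_subgrid_singleton j (update z i t)]
  exact card_le_card (layer_subset_subgrid_singleton hij hS t)

theorem cutDir_eq_sum_periodicCut (hij : i ≠ j) (hS : S ⊆ subgrid {i, j} z) :
    (cutDir j S : ℤ) = ∑ t, periodicCut (k j) #(layer i t S) := by
  rw [cutDir_eq_sum_layer hij, Nat.cast_sum]
  refine sum_congr rfl fun t _ ↦ ?_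
  have hle := card_layer_le hij hS t
  rw [cutDir_of_subset_subgrid_singleton (layer_subset_subgrid_singleton hij hS t),
    periodicCut_of_mem (Nat.cast_nonneg _) (Nat.cast_le.2 hle), Nat.cast_mul, Nat.cast_sub hle]

theorem LexInitial.exists_dvd_card_layer (hij : i < j) (hT : LexInitial (subgrid {i, j} z) T) :
    ∃ t₀, ∀ t ≠ t₀, k j ∣ #(layer i t T) := by
  obtain rfl | hne := T.eq_empty_or_nonempty
  · exact ⟨z i, by simp [layer]⟩
  obtain ⟨x, hx, hmax⟩ := exists_max_image T (fun x ↦ x i) hne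
  refine ⟨x i, fun t ht ↦ ?_⟩
  obtain hlt | hgt := lt_or_gt_of_ne ht
  · suffices layer i t T = subgrid {j} (update z i t) by rw [this, card_subgrid_singleton]
    refine (layer_subset_subgrid_singleton hij.ne hT.1 t).antisymm fun y hy ↦ ?_
    rw [← erase_insert (mt mem_singleton.1 hij.ne)] at hy
    obtain ⟨hyz, rfl⟩ := (mem_subgrid_erase (mem_insert_self i _)).1 hy
    exact mem_layer.2 ⟨hT.mem_of_apply_lt (by simp [hij.le]) hx hyz hlt, rfl⟩
  · suffices layer i t T = ∅ by simp [this]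
    refine filter_false_of_mem fun y hy hyt ↦ ?_
    exact (hmax y hy).not_gt (hyt ▸ hgt)

theorem two_mul_sum_sum_card_layer_sub (hij : i ≠ j) (hS : S ⊆ subgrid {i, j} z) :
    2 * k j * ∑ s, ∑ t, ((#(layer i s S) - #(layer i t S) : ℕ) : ℤ) =
      ∑ s, ∑ t, periodicCut (k j) (#(layer i s S) - #(layer i t S))
        + 2 * (#S * (k i * k j - #S)) - 2 * k i * cutDir j S := by
  rw [two_mul_sum_sum_sub (z j).pos (card_layer_le hij hS), cutDir_eq_sum_periodicCut hij hS,
    ← Nat.cast_sum, sum_card_layer]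

theorem le_mul_cutDir_pair (hij : i ≠ j) (hS : S ⊆ subgrid {i, j} z) (hk : k j ≤ k i) :
    (#S * (k i * k j - #S) + (2 * k i - k j - 1) * periodicCut (k j) #S : ℤ) ≤
      k j * cutDir i S + (2 * k i - k j) * cutDir j S := by
  have hcut : ∑ s, ∑ t, ((#(layer i s S) - #(layer i t S) : ℕ) : ℤ) ≤ cutDir i S := by
    exact_mod_cast sum_card_layer_sub_le_cutDir i S
  have hrect := two_mul_periodicCut_sum_le_add (z j).pos hk fun t ↦ (#(layer i t S) : ℤ)
  rw [← cutDir_eq_sum_periodicCut hij hS, ← Nat.cast_sum, sum_card_layer] at hrect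
  have hlayers := two_mul_sum_sum_card_layer_sub hij hS
  have := mul_le_mul_of_nonneg_left hcut (by positivity : (0 : ℤ) ≤ 2 * k j)
  linarith

theorem le_mul_weightedCut_pair {w : ι → ℚ} (hij : i ≠ j) (hS : S ⊆ subgrid {i, j} z)
    (hk : k j ≤ k i) (hwi : 0 ≤ w i) (hw : w i * (2 * k i - k j) ≤ w j * k j) :
    w i * (#S * (k i * k j - #S)) + (w j * k j - w i) * periodicCut (k j) #S ≤
      k j * weightedCut w {i, j} S := by
  have hm : (0 : ℤ) < k j := by exact_mod_cast (z j).pos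
  have hcomb : (#S * (k i * k j - #S) + (2 * k i - k j - 1) * periodicCut (k j) #S : ℚ) ≤
      k j * cutDir i S + (2 * k i - k j) * cutDir j S := by
    exact_mod_cast le_mul_cutDir_pair hij hS hk
  have hj : periodicCut (k j) #S ≤ cutDir j S := by
    rw [cutDir_eq_sum_periodicCut hij hS, ← sum_card_layer i, Nat.cast_sum]
    exact periodicCut_sum_le hm _ _
  have hj' : (periodicCut (k j) #S : ℚ) ≤ cutDir j S := by exact_mod_cast hj
  rw [weightedCut, sum_pair hij]
  have := mul_le_mul_of_nonneg_left hcomb hwi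
  have := mul_le_mul_of_nonneg_left hj' (sub_nonneg.2 hw)
  linarith

theorem LexInitial.mul_weightedCut_pair (w : ι → ℚ) (hij : i < j)
    (hT : LexInitial (subgrid {i, j} z) T) :
    k j * weightedCut w {i, j} T =
      w i * (#T * (k i * k j - #T)) + (w j * k j - w i) * periodicCut (k j) #T := by
  have hm : (0 : ℤ) < k j := by exact_mod_cast (z j).pos
  obtain ⟨t₀, ht₀⟩ := hT.exists_dvd_card_layer hij
  have hdvd (t) (ht : t ≠ t₀) : (k j : ℤ) ∣ #(layer i t T) := Int.natCast_dvd_natCast.2 (ht₀ t ht)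
  have hsum : ∑ t, (#(layer i t T) : ℤ) = #T := by rw [← Nat.cast_sum, sum_card_layer]
  have hj : (cutDir j T : ℤ) = periodicCut (k j) #T := by
    rw [cutDir_eq_sum_periodicCut hij.ne hT.1, sum_periodicCut_of_dvd hdvd, hsum]
  have hi : 2 * k j * (cutDir i T : ℤ) =
      2 * (#T * (k i * k j - #T)) - 2 * periodicCut (k j) #T := by
    have hlayers := hT.layersLexInitial (mem_insert_self i {j})
    have hpairs := two_mul_sum_sum_card_layer_sub hij.ne hT.1
    rw [hj, sum_sum_periodicCut_of_dvd hm hdvd, hsum] at hpairs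
    rw [hlayers.cutDir_eq (mem_insert_self i _)]
    push_cast
    linarith
  have hi' : (k j * cutDir i T : ℚ) = #T * (k i * k j - #T) - periodicCut (k j) #T := by
    exact_mod_cast (by linarith :
      (k j * cutDir i T : ℤ) = #T * (k i * k j - #T) - periodicCut (k j) #T)
  have hj' : (cutDir j T : ℚ) = periodicCut (k j) #T := by exact_mod_cast hj
  rw [weightedCut, sum_pair hij.ne, hj']
  linear_combination w i * hi'

theorem lexOptimal_of_lexImprovable {w : ι → ℚ}
    (h : ∀ S ⊆ subgrid I z, ¬ LexInitial (subgrid I z) S → LexImprovable w I z S) :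
    LexOptimal w I z := fun T hT S hS hST ↦ by
  induction hn : ∑ x ∈ S, lexRank x using Nat.strong_induction_on generalizing S with
  | _ n ih =>
    by_cases hinit : LexInitial (subgrid I z) S
    · rw [hinit.eq_of_card_eq hT hST]
    · obtain ⟨S', hS', hcard, hcut, hlt⟩ := h S hS hinit
      exact (ih _ (hn ▸ hlt) S' hS' (hcard.trans hST) rfl).trans hcut

theorem lexOptimal_singleton (w : ι → ℚ) (i : ι) (z : ∀ i, Fin (k i)) :
    LexOptimal w {i} z := fun T hT S hS hST ↦ by
  rw [weightedCut, weightedCut, sum_singleton, sum_singleton,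
    cutDir_of_subset_subgrid_singleton hS, cutDir_of_subset_subgrid_singleton hT.1, hST]

theorem lexOptimal_pair {w : ι → ℚ} (hij : i < j) (hk : k j ≤ k i) (hwi : 0 ≤ w i)
    (hw : w i * (2 * k i - k j) ≤ w j * k j) (z : ∀ i, Fin (k i)) :
    LexOptimal w {i, j} z := fun T hT S hS hST ↦ by
  have hm : (0 : ℚ) < k j := by exact_mod_cast (z j).pos
  refine le_of_mul_le_mul_left ?_ hm
  rw [hT.mul_weightedCut_pair w hij, ← hST]
  exact le_mul_weightedCut_pair hij.ne hS hk hwi hw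

theorem lexOptimal {w : ι → ℚ} (hw : ∀ i, 0 ≤ w i) (hk : Antitone k)
    (hwk : ∀ i j, i < j → w i * (2 * k i - k j) ≤ w j * k j) (I : Finset ι)
    (z : ∀ i, Fin (k i)) : LexOptimal w I z := by
  induction I using Finset.strongInduction generalizing z with
  | H I ih =>
    obtain h0 | h1 | h2 | h3 : #I = 0 ∨ #I = 1 ∨ #I = 2 ∨ 2 < #I := by lia
    · obtain rfl := card_eq_zero.1 h0
      exact fun T _ S _ _ ↦ by rw [weightedCut, weightedCut, sum_empty, sum_empty]
    · obtain ⟨i, rfl⟩ := card_eq_one.1 h1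
      exact lexOptimal_singleton w i z
    · obtain ⟨i, j, hij, rfl⟩ := card_eq_two.1 h2
      obtain hij | hij := hij.lt_or_gt
      · exact lexOptimal_pair hij (hk hij.le) (hw i) (hwk i j hij) z
      · rw [pair_comm]
        exact lexOptimal_pair hij (hk hij.le) (hw j) (hwk j i hij) z
    · have hmono (i) (_ : i ∈ I) (j) (_ : j ∈ I) (hij : i < j) : w i ≤ w j := by
        have hkij : (k j : ℚ) ≤ k i := Nat.cast_le.2 (hk hij.le)
        refine le_of_mul_le_mul_right ?_ (Nat.cast_pos.2 (z j).pos : (0 : ℚ) < k j)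
        exact (mul_le_mul_of_nonneg_left (by linarith) (hw i)).trans (hwk i j hij)
      refine lexOptimal_of_lexImprovable fun S hS hn ↦ ?_
      by_cases hlayers : ∀ i ∈ I, LayersLexInitial I z i S
      · exact lexImprovable_of_layersLexInitial h3 (fun i _ ↦ hw i) hmono hlayers hn
      · obtain ⟨i, hi, hni⟩ : ∃ i ∈ I, ¬ LayersLexInitial I z i S := by simpa using hlayers
        exact lexImprovable_of_not_layersLexInitial hi (hw i)
          (fun t ↦ ih _ (erase_ssubset hi) _) hS hni

end Pair

section Cycle

variable {V : Type*} [Fintype V] {n : ℕ}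

theorem cutSize_eq_sum [DecidableEq V] (G : SimpleGraph V) [DecidableRel G.Adj] (S : Finset V) :
    cutSize G S = ∑ x ∈ S, #{y | G.Adj x y ∧ y ∉ S} := by
  have hinter : cutSize G S = #{p ∈ S ×ˢ Sᶜ | G.Adj p.1 p.2} := by
    rw [cutSize, SimpleGraph.interedges_def]
    congr!
  rw [hinter, card_filter, sum_product]
  refine sum_congr rfl fun x _ ↦ ?_
  rw [← card_filter]
  congr 1
  ext y
  simp [and_comm]

theorem cutSize_empty (G : SimpleGraph V) : cutSize G ∅ = 0 := by
  classical simp [cutSize_eq_sum]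

theorem cutSize_univ (G : SimpleGraph V) : cutSize G univ = 0 := by
  classical simp [cutSize_eq_sum]

theorem exists_mem_add_one_notMem {A : Finset (Fin (n + 1))} (hA : A.Nonempty)
    (hA' : A ≠ univ) : ∃ s ∈ A, s + 1 ∉ A := by
  by_contra! h
  obtain ⟨a, ha⟩ := hA
  refine hA' (eq_univ_of_forall fun b ↦ ?_)
  have hmaps : Set.MapsTo (· + 1) (A : Set (Fin (n + 1))) A := h
  have hb := hmaps.iterate (b - a).val ha
  have hone : (b - a).val • (1 : Fin (n + 1)) = b - a := by
    open Fin.CommRing in rw [nsmul_one, Fin.cast_val_eq_self]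
  simpa only [add_right_iterate, hone, add_sub_cancel, mem_coe] using hb

theorem two_le_cutSize_cycleGraph (hn : 3 ≤ n) {A : Finset (Fin n)} (hA : A.Nonempty)
    (hA' : A ≠ univ) : 2 ≤ cutSize (SimpleGraph.cycleGraph n) A := by
  obtain ⟨m, rfl⟩ := Nat.exists_eq_add_of_le' hn
  obtain ⟨s, hs, hs'⟩ := exists_mem_add_one_notMem hA hA'
  obtain ⟨t, ht, ht'⟩ := exists_mem_add_one_notMem (A := Aᶜ)
    (by rwa [nonempty_iff_ne_empty, ne_eq, compl_eq_empty_iff]) (by simpa using hA.ne_empty)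
  rw [mem_compl] at ht
  rw [notMem_compl] at ht'
  have hne : (⟨s, s + 1⟩ : (_ : Fin (m + 3)) × Fin (m + 3)) ≠ ⟨t + 1, t⟩ := by
    intro h
    obtain ⟨rfl, h⟩ := Sigma.mk.inj_iff.1 h
    have h2 : (1 + 1 : Fin (m + 3)) = 0 := by simpa [add_assoc] using h
    have h2 := congrArg Fin.val h2
    rw [Fin.val_add, Fin.val_one, Fin.val_zero, Nat.mod_eq_of_lt (by lia)] at h2
    lia
  classical
  rw [cutSize_eq_sum, ← card_sigma, ← card_pair hne]
  refine card_le_card fun p hp ↦ ?_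
  obtain rfl | rfl := mem_insert.1 hp |>.imp_right mem_singleton.1
  · simp [hs, hs', SimpleGraph.cycleGraph_adj (n := m + 1)]
  · simp [ht, ht', SimpleGraph.cycleGraph_adj (n := m + 1)]

theorem cycleGraph_adj_val {s t : Fin n} (hn : 2 ≤ n) :
    (SimpleGraph.cycleGraph n).Adj s t ↔ (s : ℕ) + 1 = t ∨ (t : ℕ) + 1 = s ∨
      ((s : ℕ) = 0 ∧ (t : ℕ) + 1 = n) ∨ ((t : ℕ) = 0 ∧ (s : ℕ) + 1 = n) := by
  have hsub (u v : Fin n) :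
      (u - v).val = 1 ↔ (v : ℕ) + 1 = u ∨ ((u : ℕ) = 0 ∧ (v : ℕ) + 1 = n) := by
    rw [Fin.val_sub]
    obtain h | h := lt_or_ge (u : ℕ) v
    · rw [Nat.mod_eq_of_lt (by lia)]; lia
    · rw [show n - (v : ℕ) + u = u - v + n by lia, Nat.add_mod_right, Nat.mod_eq_of_lt (by lia)]
      lia
  rw [SimpleGraph.cycleGraph_adj', hsub, hsub]
  lia

theorem cutSize_cycleGraph_initial {a : ℕ} (hn : 3 ≤ n) (ha : 0 < a) (han : a < n) :
    cutSize (SimpleGraph.cycleGraph n) {t | (t : ℕ) < a} = 2 := by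
  classical
  have hne : (⟨⟨a - 1, by lia⟩, ⟨a, han⟩⟩ : (_ : Fin n) × Fin n) ≠
      ⟨⟨0, by lia⟩, ⟨n - 1, by lia⟩⟩ := by
    simp only [ne_eq, Sigma.mk.injEq, heq_eq_eq, Fin.mk.injEq]
    lia
  rw [cutSize_eq_sum, ← card_sigma, ← card_pair hne]
  congr 1
  ext ⟨s, t⟩
  simp only [mem_sigma, mem_filter_univ, mem_insert, mem_singleton, Sigma.mk.injEq, heq_eq_eq,
    Fin.ext_iff, cycleGraph_adj_val (show 2 ≤ n by lia)]
  lia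

end Cycle

section Fibre

variable {ι : Type*} [DecidableEq ι] [Fintype ι] {V : ι → Type*} [∀ i, Fintype (V i)]

theorem sum_sum_update {M : Type*} [AddCommMonoid M] (i : ι) (f : (∀ i, V i) → M) :
    ∑ x, ∑ s, f (update x i s) = Fintype.card (V i) • ∑ x, f x := by
  have hinv : Involutive fun p : (∀ i, V i) × V i ↦ (update p.1 i p.2, p.1 i) := fun p ↦ by simp
  have := Equiv.sum_comp hinv.toPerm fun p ↦ f p.1
  simp only [Involutive.coe_toPerm, Fintype.sum_prod_type] at this
  rw [this, smul_sum]
  simp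

variable [∀ i, DecidableEq (V i)]

/-- The values `s` for which replacing coordinate `i` of `x` by `s` gives a point of `S`: the
section of `S` along the line through `x` in direction `i`. -/
def fibre (i : ι) (S : Finset (∀ i, V i)) (x : ∀ i, V i) : Finset (V i) := {s | update x i s ∈ S}

theorem mem_fibre {i : ι} {S : Finset (∀ i, V i)} {x : ∀ i, V i} {s : V i} :
    s ∈ fibre i S x ↔ update x i s ∈ S := by simp [fibre]

theorem sum_sum_fibre {M : Type*} [AddCommMonoid M] (i : ι) (S : Finset (∀ i, V i))
    (f : (∀ i, V i) → M) :
    ∑ x, ∑ s ∈ fibre i S x, f (update x i s) = Fintype.card (V i) • ∑ x ∈ S, f x := by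
  have := sum_sum_update i fun x ↦ if x ∈ S then f x else 0
  simpa only [fibre, sum_filter, sum_ite_mem, univ_inter] using this

theorem cutSize_cartesianProduct_eq_sum (G : ∀ i, SimpleGraph (V i)) [∀ i, DecidableRel (G i).Adj]
    (S : Finset (∀ i, V i)) :
    cutSize (cartesianProduct G) S =
      ∑ i, ∑ x ∈ S, #{t | (G i).Adj (x i) t ∧ update x i t ∉ S} := by
  classical
  rw [cutSize_eq_sum, sum_comm]
  refine sum_congr rfl fun x _ ↦ ?_
  rw [← card_sigma]
  symm
  refine card_bij (fun p _ ↦ update x p.1 p.2) ?_ ?_ ?_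
  · rintro ⟨i, t⟩ hp
    simp only [mem_sigma, mem_univ, mem_filter_univ, true_and] at hp ⊢
    exact ⟨⟨i, by simpa using hp.1, fun j hj ↦ (update_of_ne hj _ _).symm⟩, hp.2⟩
  · rintro ⟨i, t⟩ hp ⟨j, s⟩ - h
    simp only [mem_sigma, mem_univ, mem_filter_univ, true_and] at hp h
    obtain rfl : i = j := by
      by_contra hij
      have hi := congrFun h i
      rw [update_self, update_of_ne hij] at hi
      exact hp.1.ne hi.symm
    rw [update_injective x i h]
  · intro y hy
    obtain ⟨⟨i, hadj, hoff⟩, hyS⟩ := mem_filter_univ _ |>.1 hy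
    have hupdate : update x i (y i) = y :=
      (eq_update_iff.2 ⟨rfl, fun j hj ↦ (hoff j hj).symm⟩).symm
    exact ⟨⟨i, y i⟩, by simpa [hupdate] using ⟨hadj, hyS⟩, hupdate⟩

theorem card_mul_sum_card_adj_notMem (G : ∀ i, SimpleGraph (V i)) [∀ i, DecidableRel (G i).Adj]
    (i : ι) (S : Finset (∀ i, V i)) :
    Fintype.card (V i) * ∑ x ∈ S, #{t | (G i).Adj (x i) t ∧ update x i t ∉ S} =
      ∑ x, cutSize (G i) (fibre i S x) := by
  rw [← smul_eq_mul, ← sum_sum_fibre]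
  simp [cutSize_eq_sum, mem_fibre]

theorem cutSize_cartesianProduct [∀ i, Nonempty (V i)] (G : ∀ i, SimpleGraph (V i))
    (S : Finset (∀ i, V i)) :
    (cutSize (cartesianProduct G) S : ℚ) =
      ∑ i, (∑ x, (cutSize (G i) (fibre i S x) : ℚ)) / Fintype.card (V i) := by
  classical
  rw [cutSize_cartesianProduct_eq_sum, Nat.cast_sum]
  refine sum_congr rfl fun i _ ↦ ?_
  rw [← Nat.cast_sum, ← card_mul_sum_card_adj_notMem, Nat.cast_mul,
    mul_div_cancel_left₀ _ (by exact_mod_cast Fintype.card_ne_zero)]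

theorem mul_cutDir {k : ι → ℕ} (i : ι) (S : Finset (∀ i, Fin (k i))) :
    k i * cutDir i S = ∑ x, #(fibre i S x) * (k i - #(fibre i S x)) := by
  have hcompl (x : ∀ i, Fin (k i)) :
      ({t | update x i t ∉ S} : Finset (Fin (k i))) = (fibre i S x)ᶜ := by
    ext t; simp [mem_fibre]
  have hsum : k i * cutDir i S =
      ∑ x, ∑ s ∈ fibre i S x, #{t | update (update x i s) i t ∉ S} := by
    rw [sum_sum_fibre (M := ℕ) i S fun x ↦ #{t | update x i t ∉ S}, Fintype.card_fin,
      smul_eq_mul, cutDir]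
  rw [hsum]
  simp only [update_idem, hcompl, card_compl, Fintype.card_fin, sum_const, smul_eq_mul]

end Fibre

section BalancedCut

/-- The cut of a balanced bisection of the complete graph on `n` vertices, which is its largest
cut. -/
def balancedCut (n : ℕ) : ℕ := n / 2 * (n - n / 2)

theorem balancedCut_pos {n : ℕ} (hn : 2 ≤ n) : 0 < balancedCut n :=
  Nat.mul_pos (by lia) (by lia)

theorem four_mul_balancedCut_add (n : ℕ) : 4 * balancedCut n + n % 2 = n ^ 2 := by
  obtain ⟨c, rfl | rfl⟩ := Nat.even_or_odd' n
  · rw [balancedCut, show 2 * c / 2 = c by lia, show 2 * c - c = c by lia,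
      show 2 * c % 2 = 0 by lia]
    ring
  · rw [balancedCut, show (2 * c + 1) / 2 = c by lia, show 2 * c + 1 - c = c + 1 by lia,
      show (2 * c + 1) % 2 = 1 by lia]
    ring

theorem mul_le_balancedCut_add (a b : ℕ) : a * b ≤ balancedCut (a + b) := by
  have h := four_mul_balancedCut_add (a + b)
  have h' : 4 * (a * b) ≤ (a + b) ^ 2 := by simpa only [mul_assoc] using four_mul_le_pow_two_add a b
  lia

theorem balancedCut_mul_le {m n : ℕ} (hnm : n ≤ m) :
    (balancedCut n : ℚ) * (2 * m - n) ≤ balancedCut m * n := by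
  obtain rfl | hlt := hnm.eq_or_lt
  · linarith
  have hm : (4 * balancedCut m + (m % 2 : ℕ) : ℚ) = m ^ 2 := mod_cast four_mul_balancedCut_add m
  have hn : (4 * balancedCut n + (n % 2 : ℕ) : ℚ) = n ^ 2 := mod_cast four_mul_balancedCut_add n
  have hm2 : ((m % 2 : ℕ) : ℚ) ≤ 1 := mod_cast Nat.lt_succ_iff.1 (Nat.mod_lt m two_pos)
  have hmn : (n : ℚ) + 1 ≤ m := mod_cast hlt
  have hsq : (1 : ℚ) ≤ (m - n) ^ 2 := one_le_pow₀ (by linarith)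
  have hpar : (n : ℚ) * (m % 2 : ℕ) ≤ n * (m - n) ^ 2 := by gcongr; linarith
  have hpar' : (0 : ℚ) ≤ (n % 2 : ℕ) * (2 * m - n) := mul_nonneg (Nat.cast_nonneg _) (by linarith)
  linear_combination (hpar + hpar' - n * hm + (2 * m - n) * hn) / 4

/-- Direction weights making the balanced bisection of every line of the grid cost `1`. -/
def balancedWeight {ι : Type*} (k : ι → ℕ) (i : ι) : ℚ := (balancedCut (k i) : ℚ)⁻¹

theorem balancedWeight_nonneg {ι : Type*} (k : ι → ℕ) (i : ι) : 0 ≤ balancedWeight k i :=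
  inv_nonneg.2 (Nat.cast_nonneg _)

theorem balancedWeight_mul_le {ι : Type*} {k : ι → ℕ} {i j : ι} (hj : 2 ≤ k j)
    (hij : k j ≤ k i) :
    balancedWeight k i * (2 * k i - k j) ≤ balancedWeight k j * k j := by
  have hcuti : (0 : ℚ) < balancedCut (k i) := mod_cast balancedCut_pos (hj.trans hij)
  have hcutj : (0 : ℚ) < balancedCut (k j) := mod_cast balancedCut_pos hj
  rw [balancedWeight, balancedWeight, inv_mul_eq_div, inv_mul_eq_div, div_le_div_iff₀ hcuti hcutj]
  linarith [balancedCut_mul_le hij]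

theorem two_mul_balancedWeight_mul_le {ι : Type*} {k : ι → ℕ} {i : ι} (hi : 3 ≤ k i)
    (A : Finset (Fin (k i))) :
    2 * balancedWeight k i * (#A * (k i - #A) : ℕ) ≤ cutSize (SimpleGraph.cycleGraph (k i)) A := by
  obtain rfl | hne := A.eq_empty_or_nonempty
  · simp
  obtain rfl | huniv := eq_or_ne A univ
  · simp
  have hcut : (0 : ℚ) < balancedCut (k i) := mod_cast balancedCut_pos (by lia)
  have hA : #A * (k i - #A) ≤ balancedCut (k i) := by
    simpa only [Nat.add_sub_cancel' (card_finset_fin_le A)] using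
      mul_le_balancedCut_add #A (k i - #A)
  calc 2 * balancedWeight k i * (#A * (k i - #A) : ℕ)
      ≤ 2 * balancedWeight k i * balancedCut (k i) := by
        have := balancedWeight_nonneg k i
        gcongr
    _ = 2 := by rw [mul_assoc, balancedWeight, inv_mul_cancel₀ hcut.ne', mul_one]
    _ ≤ cutSize (SimpleGraph.cycleGraph (k i)) A := mod_cast two_le_cutSize_cycleGraph hi hne huniv

end BalancedCut

section HalfSet

variable {ι : Type*} {k : ι → ℕ} {i : ι} {x y : ∀ i, Fin (k i)}

/-- The reflection of a point in the centre of the grid. -/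
def reflect (x : ∀ i, Fin (k i)) : ∀ i, Fin (k i) := fun i ↦ (x i).rev

theorem reflect_reflect (x : ∀ i, Fin (k i)) : reflect (reflect x) = x :=
  funext fun _ ↦ Fin.rev_rev _

theorem eq_of_reflect_eq_self (hx : reflect x = x) (hy : reflect y = y) : x = y := by
  funext i
  have hxi := congrArg Fin.val (congrFun hx i)
  have hyi := congrArg Fin.val (congrFun hy i)
  rw [reflect, Fin.val_rev] at hxi hyi
  ext; lia

variable [LinearOrder ι]

theorem toLex_reflect_lt (h : toLex x < toLex y) : toLex (reflect y) < toLex (reflect x) := by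
  obtain ⟨i, hi, hlt⟩ := toLex_lt_iff.1 h
  exact toLex_lt_iff.2 ⟨i, fun j hj ↦ by rw [reflect, reflect, hi j hj], Fin.rev_lt_rev.2 hlt⟩

variable [Fintype ι]

open Classical in
/-- The points that precede their reflection in the lexicographic order, an initial segment of half
the grid. -/
noncomputable def lexHalf (k : ι → ℕ) : Finset (∀ i, Fin (k i)) := {x | toLex x < toLex (reflect x)}

theorem mem_lexHalf : x ∈ lexHalf k ↔ toLex x < toLex (reflect x) := by simp [lexHalf]

theorem lexInitial_lexHalf (z : ∀ i, Fin (k i)) : LexInitial (subgrid univ z) (lexHalf k) :=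
  ⟨fun _ _ ↦ mem_subgrid.2 fun i hi ↦ absurd (mem_univ i) hi, fun _ hx _ _ hyx ↦
    mem_lexHalf.2 (hyx.trans ((mem_lexHalf.1 hx).trans (toLex_reflect_lt hyx)))⟩

theorem card_lexHalf : #(lexHalf k) = Fintype.card (∀ i, Fin (k i)) / 2 := by
  classical
  let upper : Finset (∀ i, Fin (k i)) := {x | toLex (reflect x) < toLex x}
  let fixed : Finset (∀ i, Fin (k i)) := {x | reflect x = x}
  have hupper : #upper = #(lexHalf k) := by
    refine card_bij' (fun x _ ↦ reflect x) (fun x _ ↦ reflect x) ?_ ?_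
      (fun x _ ↦ reflect_reflect x) fun x _ ↦ reflect_reflect x <;>
    simp [upper, mem_lexHalf, reflect_reflect]
  have hfixed : #fixed ≤ 1 := card_le_one.2 fun x hx y hy ↦
    eq_of_reflect_eq_self (mem_filter.1 hx).2 (mem_filter.1 hy).2
  have hdisj : Disjoint upper fixed := disjoint_filter.2 fun x _ hlt heq ↦ by
    rw [heq] at hlt
    exact lt_irrefl _ hlt
  have hcompl : (lexHalf k)ᶜ = upper.disjUnion fixed hdisj := by
    ext x
    simp only [mem_compl, mem_lexHalf, mem_disjUnion, upper, fixed, mem_filter_univ]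
    exact (not_lt.trans le_iff_lt_or_eq).trans (or_congr_right toLex_inj)
  have hcard := card_compl (lexHalf k)
  rw [hcompl, card_disjUnion] at hcard
  have := card_le_univ (lexHalf k)
  lia

/-- The coordinates of `x` before `i` are in the middle of their range. -/
def CentralBefore (i : ι) (x : ∀ i, Fin (k i)) : Prop := ∀ j < i, x j = (x j).rev

theorem fibre_lexHalf_of_not_centralBefore (h : ¬ CentralBefore i x) :
    fibre i (lexHalf k) x = ∅ ∨ fibre i (lexHalf k) x = univ := by
  obtain hempty | ⟨s, hs⟩ := (fibre i (lexHalf k) x).eq_empty_or_nonempty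
  · exact Or.inl hempty
  refine Or.inr (eq_univ_of_forall fun t ↦ ?_)
  rw [mem_fibre, mem_lexHalf] at hs ⊢
  simp only [CentralBefore, not_forall] at h
  obtain ⟨l, hl, hne⟩ := h
  obtain ⟨m, hm, hlt⟩ := toLex_lt_iff.1 hs
  have hml : m ≤ l := by
    by_contra! hlm
    have heq := hm l hlm
    rw [reflect, update_of_ne hl.ne] at heq
    exact hne heq
  have heq (j) (hj : j ≤ m) : update x i t j = update x i s j := by
    have hji : j ≠ i := ((hj.trans hml).trans_lt hl).ne
    rw [update_of_ne hji, update_of_ne hji]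
  refine toLex_lt_iff.2 ⟨m, fun j hj ↦ ?_, ?_⟩
  · rw [reflect, heq j hj.le]
    exact hm j hj
  · rw [reflect, heq m le_rfl]
    exact hlt

theorem CentralBefore.mem_fibre_lexHalf (h : CentralBefore i x) {t : Fin (k i)} (ht : t < t.rev) :
    t ∈ fibre i (lexHalf k) x := by
  rw [mem_fibre, mem_lexHalf]
  refine toLex_lt_iff.2 ⟨i, fun j hj ↦ ?_, ?_⟩
  · rw [reflect, update_of_ne hj.ne]
    exact h j hj
  · rwa [reflect, update_self]

theorem CentralBefore.notMem_fibre_lexHalf (h : CentralBefore i x) {t : Fin (k i)}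
    (ht : t.rev < t) : t ∉ fibre i (lexHalf k) x := by
  rw [mem_fibre, mem_lexHalf]
  refine fun hlt ↦ lt_asymm hlt (toLex_lt_iff.2 ⟨i, fun j hj ↦ ?_, ?_⟩)
  · rw [reflect, update_of_ne hj.ne]
    exact (h j hj).symm
  · rwa [reflect, update_self]

theorem CentralBefore.exists_fibre_lexHalf_eq (h : CentralBefore i x) :
    ∃ a, (a = k i / 2 ∨ a = k i - k i / 2) ∧
      fibre i (lexHalf k) x = ({t | (t : ℕ) < a} : Finset (Fin (k i))) := by
  by_cases hmid : ∃ s : Fin (k i), s = s.rev ∧ s ∈ fibre i (lexHalf k) x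
  · obtain ⟨s, hs, hmem⟩ := hmid
    have hs := congrArg Fin.val hs
    rw [Fin.val_rev] at hs
    refine ⟨k i - k i / 2, Or.inr rfl, ext fun t ↦ ?_⟩
    rw [mem_filter_univ]
    obtain ht | rfl | ht := lt_trichotomy t s
    · exact iff_of_true (h.mem_fibre_lexHalf (by rw [Fin.lt_def, Fin.val_rev]; lia)) (by lia)
    · exact iff_of_true hmem (by lia)
    · exact iff_of_false (h.notMem_fibre_lexHalf (by rw [Fin.lt_def, Fin.val_rev]; lia)) (by lia)
  · refine ⟨k i / 2, Or.inl rfl, ext fun t ↦ ?_⟩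
    have hrev := Fin.val_rev t
    rw [mem_filter_univ]
    obtain ht | ht | ht := lt_trichotomy t t.rev
    · exact iff_of_true (h.mem_fibre_lexHalf ht) (by lia)
    · exact iff_of_false (fun hmem ↦ hmid ⟨t, ht, hmem⟩) (by lia)
    · exact iff_of_false (h.notMem_fibre_lexHalf ht) (by lia)

open Classical in
theorem cutSize_fibre_lexHalf (hi : 3 ≤ k i) (x : ∀ i, Fin (k i)) :
    cutSize (SimpleGraph.cycleGraph (k i)) (fibre i (lexHalf k) x) =
      if CentralBefore i x then 2 else 0 := by
  split_ifs with h
  · obtain ⟨a, ha, hfibre⟩ := h.exists_fibre_lexHalf_eq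
    rw [hfibre, cutSize_cycleGraph_initial hi] <;> lia
  · obtain hfibre | hfibre := fibre_lexHalf_of_not_centralBefore h
    · rw [hfibre, cutSize_empty]
    · rw [hfibre, cutSize_univ]

open Classical in
theorem card_fibre_lexHalf_mul (x : ∀ i, Fin (k i)) :
    #(fibre i (lexHalf k) x) * (k i - #(fibre i (lexHalf k) x)) =
      if CentralBefore i x then balancedCut (k i) else 0 := by
  split_ifs with h
  · obtain ⟨a, ha, hfibre⟩ := h.exists_fibre_lexHalf_eq
    rw [hfibre, Fin.card_filter_val_lt, min_eq_right (by lia), balancedCut]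
    obtain rfl | rfl := ha
    · rfl
    · rw [mul_comm, Nat.sub_sub_self (Nat.div_le_self ..)]
  · obtain hfibre | hfibre := fibre_lexHalf_of_not_centralBefore h <;> simp [hfibre]

theorem cutSize_fibre_lexHalf_eq (hi : 3 ≤ k i) (x : ∀ i, Fin (k i)) :
    (cutSize (SimpleGraph.cycleGraph (k i)) (fibre i (lexHalf k) x) : ℚ) =
      2 * balancedWeight k i *
        (#(fibre i (lexHalf k) x) * (k i - #(fibre i (lexHalf k) x)) : ℕ) := by
  rw [cutSize_fibre_lexHalf hi, card_fibre_lexHalf_mul]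
  have hcut : (balancedCut (k i) : ℚ) ≠ 0 := mod_cast (balancedCut_pos (by lia)).ne'
  split_ifs
  · rw [mul_assoc, balancedWeight, inv_mul_cancel₀ hcut, mul_one, Nat.cast_two]
  · simp

theorem card_filter_eq_rev (n : ℕ) : #{t : Fin n | t = t.rev} = if Odd n then 1 else 0 := by
  split_ifs with hn
  · obtain ⟨m, rfl⟩ := hn
    refine card_eq_one.2 ⟨⟨m, by lia⟩, ext fun t ↦ ?_⟩
    rw [mem_filter_univ, mem_singleton, Fin.ext_iff, Fin.ext_iff, Fin.val_rev]
    lia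
  · refine card_eq_zero.2 (filter_eq_empty_iff.2 fun t _ ht ↦ hn ⟨t, ?_⟩)
    have ht := congrArg Fin.val ht
    rw [Fin.val_rev] at ht
    lia

open Classical in
theorem card_centralBefore [LocallyFiniteOrderTop ι] (i : ι) :
    #{x : ∀ i, Fin (k i) | CentralBefore i x} =
      if ∀ j < i, Odd (k j) then k i * ∏ j ∈ Ioi i, k j else 0 := by
  have hpi : ({x | CentralBefore i x} : Finset (∀ i, Fin (k i))) =
      Fintype.piFinset fun j ↦ if j < i then ({t | t = t.rev} : Finset (Fin (k j))) else univ := by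
    ext x
    rw [mem_filter_univ, Fintype.mem_piFinset]
    refine forall_congr' fun j ↦ ?_
    split_ifs with hj <;> simp [hj]
  have hcard (j : ι) : #(if j < i then ({t | t = t.rev} : Finset (Fin (k j))) else univ) =
      if j < i then (if Odd (k j) then 1 else 0) else k j := by
    split_ifs <;> simp_all [card_filter_eq_rev]
  rw [hpi, Fintype.card_piFinset, prod_congr rfl fun j _ ↦ hcard j]
  split_ifs with hodd
  · have hIci : ({j | ¬ j < i} : Finset ι) = insert i (Ioi i) := by
      ext j; simp [le_iff_eq_or_lt]
    rw [prod_ite, hIci, prod_insert (by simp),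
      prod_eq_one fun j hj ↦ if_pos (hodd j (mem_filter.1 hj).2), one_mul]
  · push Not at hodd
    obtain ⟨j, hj, hj'⟩ := hodd
    exact prod_eq_zero (mem_univ j) (by rw [if_pos hj, if_neg hj'])

end HalfSet

section Torus

variable {d : ℕ} {k : Fin d → ℕ}

theorem weightedCut_univ_eq {w : Fin d → ℚ} (hk : ∀ i, k i ≠ 0) (S : Finset (∀ i, Fin (k i))) :
    weightedCut w univ S =
      ∑ i, (∑ x, w i * (#(fibre i S x) * (k i - #(fibre i S x)) : ℕ)) / k i := by
  refine sum_congr rfl fun i _ ↦ ?_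
  rw [← mul_sum, ← Nat.cast_sum, ← mul_cutDir, Nat.cast_mul, mul_left_comm,
    mul_div_cancel_left₀ _ (Nat.cast_ne_zero.2 (hk i))]

theorem cutSize_torus (hk : ∀ i, k i ≠ 0) (S : Finset (∀ i, Fin (k i))) :
    (cutSize (torus k) S : ℚ) =
      ∑ i, (∑ x, (cutSize (SimpleGraph.cycleGraph (k i)) (fibre i S x) : ℚ)) / k i := by
  have (i : Fin d) : NeZero (k i) := ⟨hk i⟩
  simp only [torus, cutSize_cartesianProduct, Fintype.card_fin]

theorem two_mul_weightedCut_le_cutSize_torus (hk : ∀ i, 3 ≤ k i) (S : Finset (∀ i, Fin (k i))) :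
    2 * weightedCut (balancedWeight k) univ S ≤ cutSize (torus k) S := by
  have hk0 (i) : k i ≠ 0 := by have := hk i; lia
  rw [weightedCut_univ_eq hk0, cutSize_torus hk0, mul_sum]
  refine sum_le_sum fun i _ ↦ ?_
  rw [← mul_div_assoc, mul_sum]
  simp only [← mul_assoc]
  gcongr with x
  exact two_mul_balancedWeight_mul_le (hk i) _

theorem cutSize_torus_lexHalf_eq_weightedCut (hk : ∀ i, 3 ≤ k i) :
    (cutSize (torus k) (lexHalf k) : ℚ) =
      2 * weightedCut (balancedWeight k) univ (lexHalf k) := by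
  have hk0 (i) : k i ≠ 0 := by have := hk i; lia
  rw [weightedCut_univ_eq hk0, cutSize_torus hk0, mul_sum]
  refine sum_congr rfl fun i _ ↦ ?_
  rw [← mul_div_assoc, mul_sum]
  simp only [← mul_assoc, cutSize_fibre_lexHalf_eq (hk i)]

theorem cutSize_torus_lexHalf_le (hk : ∀ i, 3 ≤ k i) (hanti : Antitone k)
    {S : Finset (∀ i, Fin (k i))} (hS : #S = #(lexHalf k)) :
    cutSize (torus k) (lexHalf k) ≤ cutSize (torus k) S := by
  have z (i) : Fin (k i) := ⟨0, by have := hk i; lia⟩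
  have hsubset : S ⊆ subgrid univ z := fun x _ ↦
    mem_subgrid.2 fun i hi ↦ absurd (mem_univ i) hi
  have hle := lexOptimal (balancedWeight_nonneg k) hanti
    (fun i j hij ↦ balancedWeight_mul_le (by have := hk j; lia) (hanti hij.le)) univ z
    (lexInitial_lexHalf z) S hsubset hS
  have hcut : (cutSize (torus k) (lexHalf k) : ℚ) ≤ cutSize (torus k) S := by
    rw [cutSize_torus_lexHalf_eq_weightedCut hk]
    linarith [two_mul_weightedCut_le_cutSize_torus hk S]
  exact_mod_cast hcut

theorem add_one_le_lowestEvenDim_iff (i : Fin d) :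
    i.val + 1 ≤ lowestEvenDim k ↔ ∀ j < i, Odd (k j) := by
  rw [lowestEvenDim]
  simp only [← Nat.not_even_iff_odd]
  split_ifs with h
  · simp only [add_le_add_iff_right, Nat.le_find_iff, not_exists]
    exact ⟨fun hm j hj ↦ hm j hj j.2, fun hm m hmi hmd ↦ hm ⟨m, hmd⟩ hmi⟩
  · exact iff_of_true i.2 fun j _ heven ↦ h ⟨j, j.2, heven⟩

theorem cutSize_torus_lexHalf (hk : ∀ i, 3 ≤ k i) :
    cutSize (torus k) (lexHalf k) =
      2 * ∑ i ∈ univ.filter (fun i : Fin d ↦ i.val + 1 ≤ lowestEvenDim k), ∏ j ∈ Ioi i, k j := by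
  classical
  have hk0 (i) : k i ≠ 0 := by have := hk i; lia
  have hsum (i : Fin d) :
      ∑ x, (cutSize (SimpleGraph.cycleGraph (k i)) (fibre i (lexHalf k) x) : ℚ) =
        k i * (2 * if i.val + 1 ≤ lowestEvenDim k then ∏ j ∈ Ioi i, (k j : ℚ) else 0) := by
    simp only [add_one_le_lowestEvenDim_iff, ← Nat.cast_sum, cutSize_fibre_lexHalf (hk i)]
    rw [← sum_filter, sum_const, card_centralBefore]
    split_ifs
    · rw [smul_eq_mul]; push_cast; ring
    · simp
  rw [← Nat.cast_inj (R := ℚ), cutSize_torus hk0, sum_filter]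
  push_cast
  rw [mul_sum]
  refine sum_congr rfl fun i _ ↦ ?_
  rw [hsum, mul_div_cancel_left₀ _ (Nat.cast_ne_zero.2 (hk0 i))]

end Torus

theorem mainTheorem2 {d : ℕ} (k : Fin d → ℕ) (hk : ∀ i, 3 ≤ k i) (hanti : Antitone k) :
    bisectionWidth (torus k) =
      2 * ∑ i ∈ Finset.univ.filter (fun i : Fin d => i.val + 1 ≤ lowestEvenDim k),
        ∏ j ∈ Finset.Ioi i, k j := by
  rw [← cutSize_torus_lexHalf hk]
  refine le_antisymm (Nat.sInf_le ⟨lexHalf k, card_lexHalf, rfl⟩) ?_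
  refine le_csInf ⟨_, lexHalf k, card_lexHalf, rfl⟩ ?_
  rintro _ ⟨S, hS, rfl⟩
  exact cutSize_torus_lexHalf_le hk hanti (hS.trans card_lexHalf.symm)
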